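/- All graphs are finite and simple. A graph of order $n$ is bicyclic if it is connected and has exactly $n+1$ edges. For a graph $G$ with vertices $v_1,\dots,v_n$ of degrees $d_1,\dots,d_n$, the $p$-Sombor matrix $\mathbf S_p(G)$ is the real symmetric $n\times n$ matrix whose $(i,j)$ entry is $(d_i^p+d_j^p)^{1/p}$ if $v_iv_j$ is an edge and $0$ otherwise, and the $p$-Sombor spectral radius $\rho(\mathbf S_p(G))$ is its largest eigenvalue. For $n\ge 6$ define the following graphs of order $n$. - $B_1$: obtained from $K_4$ minus an edge by attaching $n-4$ pendent vertices to one of its two vertices of degree $3$. - $B_2$: obtained from two triangles sharing exactly one vertex by attaching $n-5$ pendent vertices to that common vertex. - $B_3$: obtained from $K_4$ minus an edge by attaching $n-5$ pendent vertices to one of its vertices of degree $3$ and one pendent vertex to the other vertex of degree $3$. Theorem. Let $n\ge 6$ be an integer and let $p\ge 2$ be real. Then, among all bicyclic graphs of order $n$, the graphs $B_1$, $B_2$ and $B_3$ are, respectively, the unique graphs (up to isomorphism) with the first, second and third largest $p$-Sombor spectral radius. That is, $B_1,B_2,B_3$ are bicyclic, $$\rho(\mathbf S_p(B_3))<\rho(\mathbf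 S_p(B_2))<\rho(\mathbf S_p(B_1)),$$ and $\rho(\mathbf S_p(G))<\rho(\mathbf S_p(B_3))$ for every bicyclic graph $G$ of order $n$ that is isomorphic to none of $B_1,B_2,B_3$. -/

import Mathlib

/-- A finite simple graph is bicyclic if it is connected and its number of edges is its order
plus one. -/
def IsBicyclic {V : Type*} [Fintype V] (G : SimpleGraph V) : Prop :=
  G.Connected ∧ Nat.card G.edgeSet = Fintype.card V + 1

open Classical in
/-- The `p`-Sombor matrix of a finite simple graph: the entry at an adjacent pair `i, j` is
`(d_i ^ p + d_j ^ p) ^ (1 / p)`, with `d_i` the degree of `i`; all other entries are `0`. -/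
noncomputable def pSomborMatrix {V : Type*} [Fintype V] (G : SimpleGraph V) (p : ℝ) :
    Matrix V V ℝ :=
  Matrix.of fun i j =>
    if G.Adj i j then ((G.degree i : ℝ) ^ p + (G.degree j : ℝ) ^ p) ^ (1 / p) else 0

/-- `IsEigenvalueOf M μ`: the real number `μ` is an eigenvalue of the real square matrix `M`. -/
def IsEigenvalueOf {V : Type*} [Fintype V] (M : Matrix V V ℝ) (μ : ℝ) : Prop :=
  ∃ x : V → ℝ, x ≠ 0 ∧ M.mulVec x = μ • x

/-- The `p`-Sombor spectral radius: the largest eigenvalue of the `p`-Sombor matrix.  The supremum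
is attained for every graph with at least one vertex: see `isGreatest_pSomborRadius`. -/
noncomputable def pSomborRadius {V : Type*} [Fintype V] (G : SimpleGraph V) (p : ℝ) : ℝ :=
  sSup {μ : ℝ | IsEigenvalueOf (pSomborMatrix G p) μ}

theorem pSomborMatrix_isHermitian {V : Type*} [Fintype V] (G : SimpleGraph V) (p : ℝ) :
    (pSomborMatrix G p).IsHermitian := by
  classical
  ext i j
  simp only [pSomborMatrix, Matrix.conjTranspose_apply, Matrix.of_apply, star_trivial,
    G.adj_comm j i]
  split_ifs
  · rw [add_comm]
  · rfl

theorem isGreatest_pSomborRadius {V : Type*} [Fintype V] [Nonempty V] (G : SimpleGraph V)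
    (p : ℝ) :
    IsGreatest {μ : ℝ | IsEigenvalueOf (pSomborMatrix G p) μ} (pSomborRadius G p) := by
  classical
  have key : {μ : ℝ | IsEigenvalueOf (pSomborMatrix G p) μ} =
      spectrum ℝ (pSomborMatrix G p) := by
    ext μ
    rw [Set.mem_ofPred_eq, ← Matrix.spectrum_toLin', ← Module.End.hasEigenvalue_iff_mem_spectrum]
    constructor
    · rintro ⟨x, hx, h⟩
      exact Module.End.hasEigenvalue_of_hasEigenvector
        (x := x) ⟨Module.End.mem_eigenspace_iff.2 (by simpa using h), hx⟩
    · intro h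
      obtain ⟨x, hx⟩ := h.exists_hasEigenvector
      exact ⟨x, hx.2, by simpa using hx.apply_eq_smul⟩
  have hr := (pSomborMatrix_isHermitian G p).spectrum_real_eq_range_eigenvalues
  have hfin : {μ : ℝ | IsEigenvalueOf (pSomborMatrix G p) μ}.Finite := by
    rw [key, hr]; exact Set.finite_range _
  have hne : {μ : ℝ | IsEigenvalueOf (pSomborMatrix G p) μ}.Nonempty := by
    rw [key, hr]; exact Set.range_nonempty _
  exact ⟨hne.csSup_mem hfin, fun μ h => le_csSup hfin.bddAbove h⟩

/-- `B₁` of order `n` (for `n ≥ 4`): `K₄` minus an edge on the vertices `0, 1, 2, 3`, whose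
vertices of degree three are `0` and `1`, with `n - 4` pendent vertices attached to `0`. -/
def graphB1 (n : ℕ) : SimpleGraph (Fin n) :=
  SimpleGraph.fromRel fun i j =>
    i.val = 0 ∨ (i.val = 1 ∧ (j.val = 2 ∨ j.val = 3))

/-- `B₂` of order `n` (for `n ≥ 5`): two triangles `0 1 2` and `0 3 4` sharing exactly the
vertex `0`, with `n - 5` pendent vertices attached to `0`. -/
def graphB2 (n : ℕ) : SimpleGraph (Fin n) :=
  SimpleGraph.fromRel fun i j =>
    i.val = 0 ∨ (i.val = 1 ∧ j.val = 2) ∨ (i.val = 3 ∧ j.val = 4)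

/-- `B₃` of order `n` (for `n ≥ 5`): `K₄` minus an edge on the vertices `0, 1, 2, 3`, whose
vertices of degree three are `0` and `1`, with one pendent vertex `4` attached to `1` and
`n - 5` pendent vertices attached to `0`. -/
def graphB3 (n : ℕ) : SimpleGraph (Fin n) :=
  SimpleGraph.fromRel fun i j =>
    (i.val = 0 ∧ j.val ≠ 4) ∨ (i.val = 1 ∧ (j.val = 2 ∨ j.val = 3 ∨ j.val = 4))

/-!
The proof moves neighbours from one vertex to another. Let `x` be the Perron vector of a connected
graph `G`, and let `u`, `v` be vertices with `x v ≤ x u`, neither of whose neighbourhoods contains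
the other (up to `u` and `v` themselves). The Kelmans transformation replaces all edges from `v` to
private neighbours of `v` by edges from `u`. The degree of `u` grows by the amount by which the
degree of `v` drops, all other degrees stay. Since the weight `(a ^ p + b ^ p) ^ (1 / p)` is a norm,
hence convex in `a`, no vertex loses in the quadratic form at `x` and a private neighbour of `u`
wins, so the spectral radius strictly increases (`pSomborRadius_lt_kelmans`). If `u` and `v` are
adjacent or have a common neighbour, the result is again bicyclic.

A bicyclic graph with a dominating vertex is a star plus two edges, hence `B₁` or `B₂`
(`IsBicyclic.iso_of_dominating`). Let `G` be a bicyclic graph without dominating vertex. A Kelmans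
transformation of `u`, `v` creates no dominating vertex if `u`, `v` are not adjacent, or if they
are adjacent and some vertex is adjacent to neither (`exists_lt_of_incomparable`). When no such
transformation is left, a vertex of maximal degree lies on an edge `u v` whose ends have
incomparable neighbourhoods and together dominate `G`. Then `G` is a spanning tree with the hubs
`u`, `v` plus two further edges, and going through the positions of these two edges leaves two
families (`IsBicyclic.doubleBroom_or_kite`): `K₄` minus an edge with pendent vertices at its two
vertices of degree three (a double broom), or with pendent vertices at one vertex of degree two (a
kite).

* In a double broom, moving all pendent vertices but one from the smaller hub to the other leads to
  `B₃`; the convexity of the weights makes the gain at a pendent vertex of the larger hub exceed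
  the loss at the remaining pendent vertex of the smaller one (`IsDoubleBroom.lt_or_iso`).
* For the kite, its own Perron weights, with one of them adapted, are a trial vector on `B₃` whose
  Rayleigh quotient exceeds the spectral radius of the kite (`IsKite.lt_graphB3`).

Applied to a graph of maximal spectral radius among those that are bicyclic, have no dominating
vertex and differ from `B₃`, this shows that all of them lie below `B₃` (`IsBicyclic.lt_graphB3`).

The inequality between `B₂` and `B₁` is a Kelmans transformation as well (`graphB2_lt_graphB1`).
For `B₃` and `B₂`, the eigenvalue equations of `B₃` reduce to a quadratic relation between the two
hubs, and a trial vector on `B₂` turns the claim into an inequality between weights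
(`graphB3_lt_graphB2`). Here and for the kite `p ≥ 2` enters: the squared weight of an edge is the
`p / 2`-norm of the squared degrees of its ends, so ratios of squared weights are bounded by
majorization, uniformly in `p`, by the ratios at `p = 2` (`wt_sq_le`). For order at least eight
crude bounds suffice; the orders six and seven use the ratios.
-/

/-! ### Weights of edges -/

open Set in
theorem ConvexOn.increment_le {f : ℝ → ℝ} (hf : ConvexOn ℝ (Ici 0) f) {x y k : ℝ} (hx : 0 ≤ x)
    (hxy : x ≤ y) (hk : 0 ≤ k) : f (x + k) - f x ≤ f (y + k) - f y := by
  rcases hk.eq_or_lt with rfl | hk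
  · simp
  rcases hxy.eq_or_lt with rfl | hxy
  · rfl
  -- both `x + k` and `y` are convex combinations of `x` and `y + k`, with swapped weights
  have hd : 0 < y + k - x := by linarith
  have hmem : y + k ∈ Ici (0 : ℝ) := by simp only [mem_Ici]; linarith
  have hl : 0 ≤ (y - x) / (y + k - x) := div_nonneg (by linarith) hd.le
  have hr : 0 ≤ k / (y + k - x) := div_nonneg hk.le hd.le
  have h1 := hf.2 (show x ∈ Ici (0 : ℝ) from hx) hmem hl hr (by field_simp; ring)
  have h2 := hf.2 (show x ∈ Ici (0 : ℝ) from hx) hmem hr hl (by field_simp; ring)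
  simp only [smul_eq_mul] at h1 h2
  have e1 : (y - x) / (y + k - x) * x + k / (y + k - x) * (y + k) = x + k := by
    field_simp; ring
  have e2 : k / (y + k - x) * x + (y - x) / (y + k - x) * (y + k) = y := by
    field_simp; ring
  have e3 : (y - x) / (y + k - x) + k / (y + k - x) = 1 := by field_simp; ring
  rw [e1] at h1
  rw [e2] at h2
  have e4 : (y - x) / (y + k - x) = 1 - k / (y + k - x) := by linarith
  rw [e4] at h1 h2
  linarith

/-- The weight `(a ^ p + b ^ p) ^ (1 / p)` that the `p`-Sombor matrix gives to an edge whose ends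
have degrees `a` and `b`. -/
noncomputable def wt (p a b : ℝ) : ℝ := (a ^ p + b ^ p) ^ (1 / p)

section Weight

variable {p a b c d k K : ℝ}

theorem wt_comm (p a b : ℝ) : wt p a b = wt p b a := by rw [wt, wt, add_comm]

theorem wt_nonneg (ha : 0 ≤ a) (hb : 0 ≤ b) : 0 ≤ wt p a b := by unfold wt; positivity

theorem wt_pos_left (ha : 0 < a) (hb : 0 ≤ b) : 0 < wt p a b := by unfold wt; positivity

theorem wt_pos_right (ha : 0 ≤ a) (hb : 0 < b) : 0 < wt p a b := by unfold wt; positivity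

theorem wt_rpow (hp : 0 < p) (ha : 0 ≤ a) (hb : 0 ≤ b) : wt p a b ^ p = a ^ p + b ^ p := by
  rw [wt, ← Real.rpow_mul (by positivity), one_div_mul_cancel hp.ne', Real.rpow_one]

theorem wt_le_wt_of_rpow (hp : 0 < p) (ha : 0 ≤ a) (hb : 0 ≤ b)
    (h : a ^ p + b ^ p ≤ c ^ p + d ^ p) : wt p a b ≤ wt p c d :=
  Real.rpow_le_rpow (by positivity) h (by positivity)

theorem wt_le_wt (hp : 0 < p) (ha : 0 ≤ a) (hb : 0 ≤ b) (hac : a ≤ c) (hbd : b ≤ d) :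
    wt p a b ≤ wt p c d :=
  wt_le_wt_of_rpow hp ha hb (add_le_add (Real.rpow_le_rpow ha hac hp.le)
    (Real.rpow_le_rpow hb hbd hp.le))

theorem wt_lt_wt_left (hp : 0 < p) (ha : 0 ≤ a) (hb : 0 ≤ b) (hac : a < c) :
    wt p a b < wt p c b :=
  Real.rpow_lt_rpow (by positivity) (add_lt_add_left (Real.rpow_lt_rpow ha hac hp) _)
    (by positivity)

theorem le_wt_left (hp : 0 < p) (ha : 0 ≤ a) (hb : 0 ≤ b) : a ≤ wt p a b := by
  rw [← Real.rpow_le_rpow_iff ha (wt_nonneg ha hb) hp, wt_rpow hp ha hb]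
  have := Real.rpow_nonneg hb p
  linarith

theorem mul_wt (hp : 0 < p) (hk : 0 ≤ k) (ha : 0 ≤ a) (hb : 0 ≤ b) :
    wt p (k * a) (k * b) = k * wt p a b := by
  rw [wt, wt, Real.mul_rpow hk ha, Real.mul_rpow hk hb, ← mul_add,
    Real.mul_rpow (by positivity) (by positivity), ← Real.rpow_mul hk, mul_one_div_cancel hp.ne',
    Real.rpow_one]

/-- Minkowski's inequality on `ℝ²`. -/
theorem wt_add_le (hp : 1 ≤ p) (ha : 0 ≤ a) (hb : 0 ≤ b) (hc : 0 ≤ c) (hd : 0 ≤ d) :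
    wt p (a + c) (b + d) ≤ wt p a b + wt p c d := by
  have := Real.Lp_add_le_of_nonneg (s := Finset.univ) (f := ![a, b]) (g := ![c, d]) hp
    (by simp [Fin.forall_fin_two, ha, hb]) (by simp [Fin.forall_fin_two, hc, hd])
  simpa [wt, Fin.sum_univ_two] using this

theorem convexOn_wt (hp : 1 ≤ p) (hb : 0 ≤ b) : ConvexOn ℝ (Set.Ici 0) fun x => wt p x b := by
  refine ⟨convex_Ici 0, fun x hx y hy s t hs ht hst => ?_⟩
  simp only [Set.mem_Ici, smul_eq_mul] at *
  have hp0 : 0 < p := by linarith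
  rw [← mul_wt hp0 hs hx hb, ← mul_wt hp0 ht hy hb]
  have := wt_add_le hp (mul_nonneg hs hx) (mul_nonneg hs hb) (mul_nonneg ht hy) (mul_nonneg ht hb)
  rwa [← add_mul, hst, one_mul] at this

theorem wt_increment_le (hp : 1 ≤ p) {x y : ℝ} (hb : 0 ≤ b) (hx : 0 ≤ x) (hxy : x ≤ y)
    (hk : 0 ≤ k) : wt p (x + k) b - wt p x b ≤ wt p (y + k) b - wt p y b :=
  (convexOn_wt hp hb).increment_le hx hxy hk

/-- Among pairs of degrees with a given sum, the more unequal pair has the larger weight. -/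
theorem wt_le_wt_add_sub (hp : 1 ≤ p) (ha : 0 ≤ a) (hk : 0 ≤ k) (hkb : k ≤ b) (h : b ≤ a + k) :
    wt p a b ≤ wt p (a + k) (b - k) := by
  refine wt_le_wt_of_rpow (by linarith) ha (by linarith) ?_
  have := (convexOn_rpow hp).increment_le (x := b - k) (y := a) (k := k) (by linarith)
    (by linarith) hk
  simp only [sub_add_cancel] at this
  linarith

theorem rpow_add_rpow_le_of_majorized {q A B : ℝ} (hq : 1 ≤ q) (ha : 0 ≤ a) (hb : 0 ≤ b)
    (hB : 0 ≤ B) (haA : a ≤ A) (hbA : b ≤ A) (h : a + b ≤ A + B) :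
    a ^ q + b ^ q ≤ A ^ q + B ^ q := by
  have hq0 : 0 ≤ q := by linarith
  rcases le_total b B with hbB | hbB
  · exact add_le_add (Real.rpow_le_rpow ha haA hq0) (Real.rpow_le_rpow hb hbB hq0)
  rcases le_total a B with haB | haB
  · rw [add_comm]
    exact add_le_add (Real.rpow_le_rpow hb hbA hq0) (Real.rpow_le_rpow ha haB hq0)
  have h1 := (convexOn_rpow hq).increment_le (x := B) (y := a) (k := b - B) hB haB (by linarith)
  have h2 : (a + (b - B)) ^ q ≤ A ^ q := Real.rpow_le_rpow (by linarith) (by linarith) hq0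
  simp only [add_sub_cancel] at h1
  linarith

/-- For `p ≥ 2` the squared weight is the `p / 2`-norm of the squared degrees, so squared weights
can be compared by majorization. -/
theorem wt_sq_le (hp : 2 ≤ p) (ha : 0 ≤ a) (hb : 0 ≤ b) (hc : 0 ≤ c) (hd : 0 ≤ d) (hK : 0 ≤ K)
    (h1 : a ^ 2 ≤ K * c ^ 2) (h2 : b ^ 2 ≤ K * c ^ 2) (h3 : a ^ 2 + b ^ 2 ≤ K * (c ^ 2 + d ^ 2)) :
    wt p a b ^ 2 ≤ K * wt p c d ^ 2 := by
  have hp0 : 0 < p := by linarith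
  have e : ∀ x : ℝ, 0 ≤ x → (x ^ 2) ^ (p / 2) = x ^ p := fun x hx => by
    rw [← Real.rpow_natCast, ← Real.rpow_mul hx]; congr 1; push_cast; ring
  have hw := wt_nonneg (p := p) hc hd
  have hm := rpow_add_rpow_le_of_majorized (q := p / 2) (B := K * d ^ 2) (by linarith)
    (sq_nonneg a) (sq_nonneg b) (by positivity) h1 h2 (by linarith)
  rw [Real.mul_rpow hK (by positivity), Real.mul_rpow hK (by positivity), e a ha, e b hb, e c hc,
    e d hd, ← mul_add, ← wt_rpow hp0 ha hb, ← wt_rpow hp0 hc hd, ← e _ (wt_nonneg ha hb),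
    ← e _ hw, ← Real.mul_rpow hK (by positivity)] at hm
  exact (Real.rpow_le_rpow_iff (by positivity) (by positivity) (by linarith)).1 hm

/-- Among all `p ≥ 2`, the weights at `p = 2` are the largest ones. -/
theorem wt_sq_le_sq_add_sq (hp : 2 ≤ p) (ha : 0 ≤ a) (hb : 0 ≤ b) :
    wt p a b ^ 2 ≤ a ^ 2 + b ^ 2 := by
  have h := wt_sq_le (c := 1) (d := 0) (K := a ^ 2 + b ^ 2) hp ha hb zero_le_one le_rfl
    (by positivity) (by nlinarith [sq_nonneg b]) (by nlinarith [sq_nonneg a]) (by norm_num)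
  have e : wt p 1 0 = 1 := by
    rw [wt, Real.one_rpow, Real.zero_rpow (by linarith), add_zero, Real.one_rpow]
  rw [e] at h
  linarith

end Weight

/-! ### Degrees, the quadratic form and Perron vectors -/

open Classical in
/-- The degree of a vertex, as a number independent of decidability instances. -/
noncomputable def deg {V : Type*} [Fintype V] (G : SimpleGraph V) (i : V) : ℕ :=
  (Finset.univ.filter (G.Adj i)).card

section Perron

open Matrix

variable {V : Type*} [Fintype V] {G : SimpleGraph V} {p : ℝ}

theorem degree_eq_deg (G : SimpleGraph V) (i : V) [Fintype (G.neighborSet i)] :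
    G.degree i = deg G i := by
  classical
  rw [deg, ← G.card_neighborFinset_eq_degree]
  congr 1
  ext j
  simp

theorem pSomborMatrix_of_adj {i j : V} (h : G.Adj i j) :
    pSomborMatrix G p i j = wt p (deg G i) (deg G j) := by
  simp [pSomborMatrix, h, wt, degree_eq_deg]

theorem pSomborMatrix_of_not_adj {i j : V} (h : ¬ G.Adj i j) : pSomborMatrix G p i j = 0 := by
  simp [pSomborMatrix, h]

theorem pSomborMatrix_comm (i j : V) : pSomborMatrix G p i j = pSomborMatrix G p j i :=
  (pSomborMatrix_isHermitian G p).apply j i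

theorem deg_pos_of_adj {i j : V} (h : G.Adj i j) : 0 < deg G i :=
  Finset.card_pos.2 ⟨j, by simp [h]⟩

theorem pSomborMatrix_pos {i j : V} (h : G.Adj i j) : 0 < pSomborMatrix G p i j := by
  rw [pSomborMatrix_of_adj h]
  exact wt_pos_left (by exact_mod_cast deg_pos_of_adj h) (Nat.cast_nonneg _)

theorem pSomborMatrix_nonneg (i j : V) : 0 ≤ pSomborMatrix G p i j := by
  by_cases h : G.Adj i j
  · exact (pSomborMatrix_pos h).le
  · rw [pSomborMatrix_of_not_adj h]

theorem posSemidef_pSomborRadius [Nonempty V] [DecidableEq V] :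
    (pSomborRadius G p • (1 : Matrix V V ℝ) - pSomborMatrix G p).PosSemidef := by
  have hH : (pSomborRadius G p • (1 : Matrix V V ℝ) - pSomborMatrix G p).IsHermitian :=
    (Matrix.isHermitian_one.smul (IsSelfAdjoint.all _)).sub (pSomborMatrix_isHermitian G p)
  rw [hH.posSemidef_iff_eigenvalues_nonneg]
  intro i
  have h := hH.mulVec_eigenvectorBasis i
  rw [sub_mulVec, smul_mulVec, one_mulVec] at h
  have : IsEigenvalueOf (pSomborMatrix G p) (pSomborRadius G p - hH.eigenvalues i) := by
    refine ⟨(hH.eigenvectorBasis i).ofLp,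
      fun h0 => hH.eigenvectorBasis.orthonormal.ne_zero i ?_, ?_⟩
    · ext j; exact congrFun h0 j
    · rw [sub_smul, ← h]; abel
  simpa using (isGreatest_pSomborRadius G p).2 this

theorem dotProduct_mulVec_le [Nonempty V] (x : V → ℝ) :
    x ⬝ᵥ pSomborMatrix G p *ᵥ x ≤ pSomborRadius G p * (x ⬝ᵥ x) := by
  classical
  have := (posSemidef_pSomborRadius (G := G) (p := p)).dotProduct_mulVec_nonneg x
  rw [sub_mulVec, smul_mulVec, one_mulVec, star_trivial, dotProduct_sub, dotProduct_smul] at this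
  simpa using this

theorem lt_pSomborRadius [Nonempty V] {r : ℝ} (x : V → ℝ)
    (h : r * (x ⬝ᵥ x) < x ⬝ᵥ pSomborMatrix G p *ᵥ x) : r < pSomborRadius G p := by
  have h1 := h.trans_le (dotProduct_mulVec_le x)
  exact lt_of_mul_lt_mul_right h1 (by simpa using dotProduct_star_self_nonneg x)

/-- A connected graph has a positive Perron vector. -/
theorem exists_perron_vector (hG : G.Connected) :
    ∃ x : V → ℝ, (∀ i, 0 < x i) ∧
      ∀ i, ∑ j, pSomborMatrix G p i j * x j = pSomborRadius G p * x i := by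
  classical
  have := hG.nonempty
  obtain ⟨x, hx, hS⟩ := (isGreatest_pSomborRadius G p).1
  -- the entrywise absolute value of an eigenvector is again a maximizer of the quadratic form
  set y : V → ℝ := fun i => |x i| with hy
  have hyy : y ⬝ᵥ y = x ⬝ᵥ x := by simp [dotProduct, hy]
  have hle : pSomborRadius G p * (y ⬝ᵥ y) ≤ y ⬝ᵥ pSomborMatrix G p *ᵥ y := by
    rw [hyy, ← smul_eq_mul, ← dotProduct_smul, ← hS]
    simp only [dotProduct, mulVec, Finset.mul_sum]
    refine Finset.sum_le_sum fun i _ => Finset.sum_le_sum fun j _ => ?_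
    refine (le_abs_self _).trans_eq ?_
    rw [abs_mul, abs_mul, abs_of_nonneg (pSomborMatrix_nonneg i j)]
  have hy0 : (pSomborRadius G p • (1 : Matrix V V ℝ) - pSomborMatrix G p) *ᵥ y = 0 := by
    rw [← posSemidef_pSomborRadius.dotProduct_mulVec_zero_iff, star_trivial, sub_mulVec,
      smul_mulVec, one_mulVec, dotProduct_sub, dotProduct_smul, smul_eq_mul]
    linarith [dotProduct_mulVec_le (G := G) (p := p) y]
  have hyS : ∀ i, ∑ j, pSomborMatrix G p i j * y j = pSomborRadius G p * y i := fun i => by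
    have := congrFun hy0 i
    rw [sub_mulVec, smul_mulVec, one_mulVec] at this
    simp only [Pi.sub_apply, Pi.smul_apply, smul_eq_mul, Pi.zero_apply, mulVec, dotProduct] at this
    linarith
  refine ⟨y, fun i => (abs_nonneg _).lt_of_ne' fun h0 => hx ?_, hyS⟩
  -- the zero set of `y` is closed under adjacency
  have step : ∀ i j, y i = 0 → G.Adj i j → y j = 0 := fun i j hi hij => by
    have h := hyS i
    rw [hi, mul_zero, Finset.sum_eq_zero_iff_of_nonneg
      (fun j _ => mul_nonneg (pSomborMatrix_nonneg i j) (abs_nonneg _))] at h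
    exact (mul_eq_zero.1 (h j (Finset.mem_univ j))).resolve_left (pSomborMatrix_pos hij).ne'
  ext j
  have hr := (G.reachable_iff_reflTransGen i j).1 (hG.preconnected i j)
  have : y j = 0 := by
    induction hr with
    | refl => exact h0
    | tail _ hbc ih => exact step _ _ ih hbc
  simpa [hy] using this

theorem pSomborRadius_pos [Nontrivial V] (hG : G.Connected) : 0 < pSomborRadius G p := by
  obtain ⟨x, hx, hS⟩ := exists_perron_vector (p := p) hG
  obtain ⟨i⟩ := hG.nonempty
  obtain ⟨j, hij⟩ := hG.preconnected.exists_adj_of_nontrivial i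
  have : 0 < ∑ j, pSomborMatrix G p i j * x j :=
    Finset.sum_pos' (fun j _ => mul_nonneg (pSomborMatrix_nonneg i j) (hx j).le)
      ⟨j, Finset.mem_univ j, mul_pos (pSomborMatrix_pos hij) (hx j)⟩
  rw [hS] at this
  exact pos_of_mul_pos_left this (hx i).le

theorem deg_iso {W : Type*} [Fintype W] {H : SimpleGraph W} (e : G ≃g H) (i : V) :
    deg H (e i) = deg G i := by
  classical
  rw [deg, deg]
  symm
  refine Finset.card_bij (fun j _ => e j) (fun j hj => ?_) (fun a _ b _ h => e.injective h)
    fun j hj => ?_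
  · simpa using e.map_adj_iff.2 (Finset.mem_filter.1 hj).2
  · obtain ⟨k, rfl⟩ := e.surjective j
    exact ⟨k, by simpa using e.map_adj_iff.1 (Finset.mem_filter.1 hj).2, rfl⟩

theorem pSomborRadius_iso {W : Type*} [Fintype W] {H : SimpleGraph W} (e : G ≃g H) :
    pSomborRadius G p = pSomborRadius H p := by
  have hM : ∀ i j, pSomborMatrix H p (e i) (e j) = pSomborMatrix G p i j := fun i j => by
    by_cases h : G.Adj i j
    · rw [pSomborMatrix_of_adj h, pSomborMatrix_of_adj (e.map_adj_iff.2 h), deg_iso, deg_iso]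
    · rw [pSomborMatrix_of_not_adj h, pSomborMatrix_of_not_adj (mt e.map_adj_iff.1 h)]
  unfold pSomborRadius
  congr 1
  ext μ
  constructor
  · rintro ⟨x, hx, h⟩
    refine ⟨x ∘ e.symm, fun h0 => hx ?_, ?_⟩
    · ext i; simpa using congrFun h0 (e i)
    · ext i
      obtain ⟨i, rfl⟩ := e.surjective i
      have := congrFun h i
      simp only [mulVec, dotProduct, Pi.smul_apply, Function.comp_apply] at this ⊢
      rw [← e.toEquiv.sum_comp]
      simpa [hM] using this
  · rintro ⟨x, hx, h⟩
    refine ⟨x ∘ e, fun h0 => hx ?_, ?_⟩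
    · ext i; simpa using congrFun h0 (e.symm i)
    · ext i
      have := congrFun h (e i)
      simp only [mulVec, dotProduct, Pi.smul_apply, Function.comp_apply] at this ⊢
      rw [← e.toEquiv.sum_comp] at this
      simpa [hM] using this

end Perron

/-! ### Shifting neighbours and the Kelmans transformation -/

section Shift

variable {V : Type*} {G : SimpleGraph V} {u v : V} {M : Finset V}

/-- The graph obtained from `G` by replacing, for every `m ∈ M`, the edge `v m` by `u m`.  It is
used for sets `M` of neighbours of `v` that are neither `u` nor adjacent to `u`. -/
def shift (G : SimpleGraph V) (u v : V) (M : Finset V) : SimpleGraph V :=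
  SimpleGraph.fromRel fun i j =>
    (G.Adj i j ∧ ¬ (i = v ∧ j ∈ M) ∧ ¬ (j = v ∧ i ∈ M)) ∨ (i = u ∧ j ∈ M)

/-- The vertices `u`, `v` are distinct, and all elements of `M` are neighbours of `v` that can be
shifted to `u`: they differ from `u` and are not adjacent to `u`. -/
def Shiftable (G : SimpleGraph V) (u v : V) (M : Finset V) : Prop :=
  u ≠ v ∧ ∀ m ∈ M, G.Adj v m ∧ ¬ G.Adj u m ∧ m ≠ u

theorem shift_adj (h : Shiftable G u v M) {i j : V} : (shift G u v M).Adj i j ↔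
    (G.Adj i j ∧ ¬ (i = v ∧ j ∈ M) ∧ ¬ (j = v ∧ i ∈ M)) ∨ (i = u ∧ j ∈ M) ∨ (j = u ∧ i ∈ M) := by
  simp only [shift, SimpleGraph.fromRel_adj]
  constructor
  · rintro ⟨_, (h1 | h1) | (h1 | h1)⟩
    · exact Or.inl h1
    · exact Or.inr (Or.inl h1)
    · exact Or.inl ⟨h1.1.symm, h1.2.2, h1.2.1⟩
    · exact Or.inr (Or.inr h1)
  · rintro (h1 | h1 | h1)
    · exact ⟨h1.1.ne, Or.inl (Or.inl h1)⟩
    · exact ⟨fun e => (h.2 j h1.2).2.2 (e ▸ h1.1), Or.inl (Or.inr h1)⟩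
    · exact ⟨fun e => (h.2 i h1.2).2.2 (e ▸ h1.1), Or.inr (Or.inr h1)⟩

theorem Shiftable.ne_right (h : Shiftable G u v M) {m : V} (hm : m ∈ M) : m ≠ v :=
  (h.2 m hm).1.ne'

theorem shift_adj_left (h : Shiftable G u v M) {j : V} :
    (shift G u v M).Adj u j ↔ G.Adj u j ∨ j ∈ M := by
  rw [shift_adj h]
  have h1 := h.1
  have h2 : u ∉ M := fun hu => (h.2 u hu).2.2 rfl
  tauto

theorem shift_adj_right (h : Shiftable G u v M) {j : V} :
    (shift G u v M).Adj v j ↔ G.Adj v j ∧ j ∉ M := by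
  rw [shift_adj h]
  have h1 := h.1.symm
  have h2 : v ∉ M := fun hu => h.ne_right hu rfl
  tauto

theorem shift_adj_of_ne (h : Shiftable G u v M) {i j : V} (hiu : i ≠ u) (hiv : i ≠ v)
    (hju : j ≠ u) (hjv : j ≠ v) : (shift G u v M).Adj i j ↔ G.Adj i j := by
  rw [shift_adj h]
  tauto

variable [Fintype V]

theorem deg_shift_left (h : Shiftable G u v M) : deg (shift G u v M) u = deg G u + M.card := by
  classical
  rw [deg, deg, ← Finset.card_union_of_disjoint]
  · congr 1
    ext j
    simp [shift_adj_left h]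
  · rw [Finset.disjoint_left]
    intro j hj hM
    exact (h.2 j hM).2.1 (by simpa using hj)

theorem deg_shift_right (h : Shiftable G u v M) :
    deg (shift G u v M) v + M.card = deg G v := by
  classical
  rw [deg, deg, ← Finset.card_union_of_disjoint]
  · congr 1
    ext j
    have := fun hj => (h.2 j hj).1
    simp only [shift_adj_right h, Finset.mem_union, Finset.mem_filter, Finset.mem_univ, true_and]
    tauto
  · rw [Finset.disjoint_left]
    intro j hj hM
    simp [shift_adj_right h, hM] at hj

theorem deg_shift_of_ne (h : Shiftable G u v M) {j : V} (hju : j ≠ u) (hjv : j ≠ v) :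
    deg (shift G u v M) j = deg G j := by
  classical
  by_cases hj : j ∈ M
  · have h1 := h.2 j hj
    -- the neighbour `v` of `j` is replaced by `u`
    have e1 : Finset.univ.filter (G.Adj j) =
        insert v (Finset.univ.filter fun i => G.Adj j i ∧ i ≠ v) := by
      ext i
      simp only [Finset.mem_filter, Finset.mem_univ, true_and, Finset.mem_insert]
      by_cases hi : i = v
      · simp [hi, h1.1.symm]
      · simp [hi]
    have e2 : Finset.univ.filter ((shift G u v M).Adj j) =
        insert u (Finset.univ.filter fun i => G.Adj j i ∧ i ≠ v) := by
      ext i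
      simp only [Finset.mem_filter, Finset.mem_univ, true_and, Finset.mem_insert, shift_adj h]
      tauto
    rw [deg, deg, e1, e2, Finset.card_insert_of_notMem, Finset.card_insert_of_notMem]
    · simp
    · simp [G.adj_comm j u, h1.2.1]
  · rw [deg, deg]
    congr 1
    ext i
    simp only [Finset.mem_filter, Finset.mem_univ, true_and, shift_adj h]
    tauto

theorem sum_deg (G : SimpleGraph V) : ∑ i, deg G i = 2 * Nat.card G.edgeSet := by
  classical
  have := G.sum_degrees_eq_twice_card_edges
  simp only [degree_eq_deg] at this
  rw [this, ← G.coe_edgeFinset, Nat.card_coe_set_eq, Set.ncard_coe_finset]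

/-- The last hypothesis makes sure that `u` and `v` remain in the same component. -/
theorem isBicyclic_shift (hG : IsBicyclic G) (h : Shiftable G u v M)
    (huv : G.Adj u v ∨ ∃ w, G.Adj u w ∧ G.Adj v w) : IsBicyclic (shift G u v M) := by
  classical
  constructor
  · have hr : (shift G u v M).Reachable v u := by
      rcases huv with huv | ⟨w, hu, hv⟩
      · exact ((shift_adj_left h).2 (Or.inl huv)).symm.reachable
      · have hw : w ∉ M := fun hw => (h.2 w hw).2.1 hu
        exact ((shift_adj_right h).2 ⟨hv, hw⟩).reachable.trans
          ((shift_adj_left h).2 (Or.inl hu)).symm.reachable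
    have step : ∀ i j, G.Adj i j → (shift G u v M).Reachable i j := fun i j hij => by
      by_cases h1 : i = v ∧ j ∈ M
      · rw [h1.1]
        exact hr.trans ((shift_adj_left h).2 (Or.inr h1.2)).reachable
      by_cases h2 : j = v ∧ i ∈ M
      · rw [h2.1]
        exact ((shift_adj_left h).2 (Or.inr h2.2)).symm.reachable.trans hr.symm
      exact ((shift_adj h).2 (Or.inl ⟨hij, h1, h2⟩)).reachable
    have := hG.1.nonempty
    refine ⟨fun i j => ?_⟩
    have hij := (G.reachable_iff_reflTransGen i j).1 (hG.1.preconnected i j)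
    induction hij with
    | refl => exact SimpleGraph.Reachable.refl _
    | tail _ hbc ih => exact ih.trans (step _ _ hbc)
  · rw [← hG.2]
    refine Nat.eq_of_mul_eq_mul_left two_pos ?_
    rw [← sum_deg, ← sum_deg, ← Finset.add_sum_erase _ _ (Finset.mem_univ u),
      ← Finset.add_sum_erase _ (deg G) (Finset.mem_univ u),
      ← Finset.add_sum_erase _ _ (Finset.mem_erase.2 ⟨h.1.symm, Finset.mem_univ v⟩),
      ← Finset.add_sum_erase _ (deg G) (Finset.mem_erase.2 ⟨h.1.symm, Finset.mem_univ v⟩),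
      deg_shift_left h, ← deg_shift_right h]
    rw [Finset.sum_congr rfl fun j hj => deg_shift_of_ne h
      (Finset.ne_of_mem_erase (Finset.mem_of_mem_erase hj)) (Finset.ne_of_mem_erase hj)]
    ring

end Shift

section Quadratic

open Matrix

variable {V : Type*} [Fintype V] {G : SimpleGraph V} {p : ℝ} {u v : V} {M : Finset V}

open Classical in
/-- The quadratic form of a symmetric matrix supported on two rows and the corresponding columns,
with zero diagonal. -/
theorem dotProduct_mulVec_of_two_rows {E : Matrix V V ℝ} (huv : u ≠ v) (hs : ∀ i j, E i j = E j i)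
    (hu : E u u = 0) (hv : E v v = 0)
    (h0 : ∀ i j, i ≠ u → i ≠ v → j ≠ u → j ≠ v → E i j = 0) (x : V → ℝ) :
    x ⬝ᵥ E *ᵥ x = 2 * (E u v * x u * x v +
      ∑ j ∈ (Finset.univ.erase u).erase v, (E u j * x u + E v j * x v) * x j) := by
  have hmem : v ∈ Finset.univ.erase u := Finset.mem_erase.2 ⟨huv.symm, Finset.mem_univ v⟩
  have split : ∀ f : V → ℝ, ∑ j, f j = f u + (f v + ∑ j ∈ (Finset.univ.erase u).erase v, f j) :=
    fun f => by rw [Finset.add_sum_erase _ _ hmem, Finset.add_sum_erase _ _ (Finset.mem_univ u)]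
  have hrest : ∀ i ∈ (Finset.univ.erase u).erase v,
      x i * (E *ᵥ x) i = (E u i * x u + E v i * x v) * x i := fun i hi => by
    have hiv := Finset.ne_of_mem_erase hi
    have hiu := Finset.ne_of_mem_erase (Finset.mem_of_mem_erase hi)
    rw [mulVec, dotProduct, split, Finset.sum_eq_zero, hs i u, hs i v]
    · ring
    · intro j hj
      rw [h0 i j hiu hiv (Finset.ne_of_mem_erase (Finset.mem_of_mem_erase hj))
        (Finset.ne_of_mem_erase hj), zero_mul]
  have eu : (E *ᵥ x) u = E u v * x v + ∑ j ∈ (Finset.univ.erase u).erase v, E u j * x j := by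
    rw [mulVec, dotProduct, split, hu]; ring
  have ev : (E *ᵥ x) v = E u v * x u + ∑ j ∈ (Finset.univ.erase u).erase v, E v j * x j := by
    rw [mulVec, dotProduct, split, hv, hs v u]; ring
  have e : ∑ j ∈ (Finset.univ.erase u).erase v, (E u j * x u + E v j * x v) * x j =
      x u * ∑ j ∈ (Finset.univ.erase u).erase v, E u j * x j +
        x v * ∑ j ∈ (Finset.univ.erase u).erase v, E v j * x j := by
    rw [Finset.mul_sum, Finset.mul_sum, ← Finset.sum_add_distrib]
    exact Finset.sum_congr rfl fun j _ => by ring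
  rw [dotProduct, split, Finset.sum_congr rfl hrest, eu, ev, e]
  ring

/-- The change that a shift causes in the entry at `j`, a vertex outside `{u, v}`, of the product of
the `p`-Sombor matrix with `x`. -/
noncomputable def shiftGain (p : ℝ) (G : SimpleGraph V) (u v : V) (M : Finset V) (x : V → ℝ)
    (j : V) : ℝ :=
  (pSomborMatrix (shift G u v M) p u j - pSomborMatrix G p u j) * x u +
    (pSomborMatrix (shift G u v M) p v j - pSomborMatrix G p v j) * x v

open Classical in
/-- A shift increases the spectral radius if it increases the quadratic form at the Perron vector.
The hypothesis on the degrees makes sure that the edge `u v`, if present, loses no weight, so it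
suffices to look at the vertices outside `{u, v}`. -/
theorem pSomborRadius_lt_shift [Nonempty V] (hp : 1 ≤ p) (h : Shiftable G u v M) {x : V → ℝ}
    (hx : ∀ i, 0 < x i) (hS : ∀ i, ∑ j, pSomborMatrix G p i j * x j = pSomborRadius G p * x i)
    (hd : deg G v ≤ deg G u + M.card)
    (hpos : 0 < ∑ j ∈ (Finset.univ.erase u).erase v, shiftGain p G u v M x j * x j) :
    pSomborRadius G p < pSomborRadius (shift G u v M) p := by
  apply lt_pSomborRadius x
  have e1 : x ⬝ᵥ pSomborMatrix G p *ᵥ x = pSomborRadius G p * (x ⬝ᵥ x) := by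
    simp only [dotProduct, mulVec, hS, Finset.mul_sum]
    exact Finset.sum_congr rfl fun i _ => by ring
  have hnadj : ∀ (H : SimpleGraph V) i, pSomborMatrix H p i i = 0 :=
    fun H i => pSomborMatrix_of_not_adj (H.loopless.irrefl i)
  have key := dotProduct_mulVec_of_two_rows
    (E := pSomborMatrix (shift G u v M) p - pSomborMatrix G p) h.1
    (fun i j => by simp [pSomborMatrix_comm i j]) (by simp [hnadj]) (by simp [hnadj])
    (fun i j hiu hiv hju hjv => by
      by_cases hij : G.Adj i j
      · rw [Matrix.sub_apply, pSomborMatrix_of_adj hij,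
          pSomborMatrix_of_adj ((shift_adj_of_ne h hiu hiv hju hjv).2 hij),
          deg_shift_of_ne h hiu hiv, deg_shift_of_ne h hju hjv, sub_self]
      · rw [Matrix.sub_apply, pSomborMatrix_of_not_adj hij,
          pSomborMatrix_of_not_adj (mt (shift_adj_of_ne h hiu hiv hju hjv).1 hij), sub_self]) x
  rw [sub_mulVec, dotProduct_sub, e1] at key
  have huv : 0 ≤ (pSomborMatrix (shift G u v M) p - pSomborMatrix G p) u v * x u * x v := by
    refine mul_nonneg (mul_nonneg ?_ (hx u).le) (hx v).le
    have hvM : v ∉ M := fun hv => h.ne_right hv rfl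
    rw [Matrix.sub_apply]
    by_cases hij : G.Adj u v
    · rw [pSomborMatrix_of_adj hij, pSomborMatrix_of_adj ((shift_adj_left h).2 (Or.inl hij)),
        deg_shift_left h]
      have e2 : (deg (shift G u v M) v : ℝ) = deg G v - M.card := by
        rw [← deg_shift_right h]; push_cast; ring
      have h3 := deg_shift_right h
      rw [e2, Nat.cast_add, sub_nonneg]
      exact wt_le_wt_add_sub hp (Nat.cast_nonneg _) (Nat.cast_nonneg _)
        (by exact_mod_cast (by omega : M.card ≤ deg G v)) (by exact_mod_cast hd)
    · rw [pSomborMatrix_of_not_adj hij, sub_zero]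
      exact pSomborMatrix_nonneg _ _
  simp only [Matrix.sub_apply] at key huv
  unfold shiftGain at hpos
  linarith

section Gain

variable {x : V → ℝ} {j : V}

theorem shiftGain_of_adj_adj (hp : 1 ≤ p) (h : Shiftable G u v M) (hx : ∀ i, 0 < x i)
    (hxx : x v ≤ x u) (hd : deg G v ≤ deg G u + M.card) (hju : G.Adj u j) (hjv : G.Adj v j) :
    0 ≤ shiftGain p G u v M x j := by
  have hjM : j ∉ M := fun hj => (h.2 j hj).2.1 hju
  have h3 := deg_shift_right h
  rw [shiftGain, pSomborMatrix_of_adj hju, pSomborMatrix_of_adj hjv,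
    pSomborMatrix_of_adj ((shift_adj_left h).2 (Or.inl hju)),
    pSomborMatrix_of_adj ((shift_adj_right h).2 ⟨hjv, hjM⟩), deg_shift_left h,
    deg_shift_of_ne h hju.ne' hjv.ne', ← h3, Nat.cast_add, Nat.cast_add]
  have h1 := wt_increment_le (b := deg G j) (x := deg (shift G u v M) v) (y := deg G u)
    (k := M.card) hp (Nat.cast_nonneg _) (Nat.cast_nonneg _)
    (by exact_mod_cast (by omega : deg (shift G u v M) v ≤ deg G u)) (Nat.cast_nonneg _)
  have h2 : wt p (deg (shift G u v M) v) (deg G j) ≤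
      wt p (deg (shift G u v M) v + M.card) (deg G j) :=
    wt_le_wt (by linarith) (Nat.cast_nonneg _) (Nat.cast_nonneg _)
      (le_add_of_nonneg_right (Nat.cast_nonneg _)) le_rfl
  nlinarith [hx u, hx v]

theorem shiftGain_of_mem (hp : 1 ≤ p) (h : Shiftable G u v M) (hx : ∀ i, 0 < x i)
    (hxx : x v ≤ x u) (hd : deg G v ≤ deg G u + M.card) (hj : j ∈ M) :
    0 ≤ shiftGain p G u v M x j ∧
      (deg G v < deg G u + M.card → 0 < shiftGain p G u v M x j) := by
  have h1 := h.2 j hj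
  have hw := wt_pos_right (p := p) (a := deg G v) (b := deg G j) (Nat.cast_nonneg _)
    (by exact_mod_cast deg_pos_of_adj h1.1.symm)
  rw [shiftGain, pSomborMatrix_of_adj h1.1, pSomborMatrix_of_not_adj h1.2.1,
    pSomborMatrix_of_adj ((shift_adj_left h).2 (Or.inr hj)),
    pSomborMatrix_of_not_adj (mt (shift_adj_right h).1 fun h => h.2 hj), deg_shift_left h,
    deg_shift_of_ne h h1.2.2 h1.1.ne']
  constructor
  · have h2 : wt p (deg G v) (deg G j) ≤ wt p (deg G u + M.card : ℕ) (deg G j) :=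
      wt_le_wt (by linarith) (Nat.cast_nonneg _) (Nat.cast_nonneg _) (by exact_mod_cast hd) le_rfl
    nlinarith [hx u, hx v]
  · intro hlt
    have h2 : wt p (deg G v) (deg G j) < wt p (deg G u + M.card : ℕ) (deg G j) :=
      wt_lt_wt_left (by linarith) (Nat.cast_nonneg _) (Nat.cast_nonneg _) (by exact_mod_cast hlt)
    nlinarith [hx u, hx v]

theorem shiftGain_of_adj_left (h : Shiftable G u v M) (hju : G.Adj u j) (hjv : ¬ G.Adj v j)
    (hne : j ≠ v) : shiftGain p G u v M x j =
      (wt p (deg G u + M.card) (deg G j) - wt p (deg G u) (deg G j)) * x u := by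
  rw [shiftGain, pSomborMatrix_of_adj hju, pSomborMatrix_of_not_adj hjv,
    pSomborMatrix_of_adj ((shift_adj_left h).2 (Or.inl hju)),
    pSomborMatrix_of_not_adj (mt (shift_adj_right h).1 fun h => hjv h.1), deg_shift_left h,
    deg_shift_of_ne h hju.ne' hne, Nat.cast_add]
  ring

theorem shiftGain_of_adj_left_pos (hp : 0 < p) (h : Shiftable G u v M) (hx : ∀ i, 0 < x i)
    (hM : M.Nonempty) (hju : G.Adj u j) (hjv : ¬ G.Adj v j) (hne : j ≠ v) :
    0 < shiftGain p G u v M x j := by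
  rw [shiftGain_of_adj_left h hju hjv hne]
  have : wt p (deg G u) (deg G j) < wt p (deg G u + M.card) (deg G j) :=
    wt_lt_wt_left hp (Nat.cast_nonneg _) (Nat.cast_nonneg _)
      (lt_add_of_pos_right _ (by exact_mod_cast hM.card_pos))
  exact mul_pos (by linarith) (hx u)

theorem shiftGain_of_adj_right (h : Shiftable G u v M) (hju : ¬ G.Adj u j) (hjv : G.Adj v j)
    (hne : j ≠ u) (hjM : j ∉ M) : shiftGain p G u v M x j =
      (wt p (deg (shift G u v M) v) (deg G j) - wt p (deg G v) (deg G j)) * x v := by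
  rw [shiftGain, pSomborMatrix_of_adj hjv, pSomborMatrix_of_not_adj hju,
    pSomborMatrix_of_not_adj (mt (shift_adj_left h).1 fun h => h.elim hju hjM),
    pSomborMatrix_of_adj ((shift_adj_right h).2 ⟨hjv, hjM⟩),
    deg_shift_of_ne h hne hjv.ne']
  ring

theorem shiftGain_of_not_adj (h : Shiftable G u v M) (hju : ¬ G.Adj u j) (hjv : ¬ G.Adj v j) :
    shiftGain p G u v M x j = 0 := by
  have hjM : j ∉ M := fun hj => hjv (h.2 j hj).1
  rw [shiftGain, pSomborMatrix_of_not_adj hju, pSomborMatrix_of_not_adj hjv,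
    pSomborMatrix_of_not_adj (mt (shift_adj_left h).1 fun h => h.elim hju hjM),
    pSomborMatrix_of_not_adj (mt (shift_adj_right h).1 fun h => hjv h.1)]
  ring

end Gain

open Classical in
/-- The Kelmans transformation: moving all private neighbours of `v` to a vertex `u` that has a
private neighbour and is at least as heavy in the Perron vector increases the spectral radius. -/
theorem pSomborRadius_lt_kelmans (hp : 1 ≤ p) [Nonempty V] (h : Shiftable G u v M) {x : V → ℝ}
    (hx : ∀ i, 0 < x i) (hS : ∀ i, ∑ j, pSomborMatrix G p i j * x j = pSomborRadius G p * x i)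
    (hxx : x v ≤ x u) (hM : ∀ j, G.Adj v j → ¬ G.Adj u j → j ≠ u → j ∈ M) (hne : M.Nonempty)
    {a : V} (hua : G.Adj u a) (hva : ¬ G.Adj v a) (hav : a ≠ v) :
    pSomborRadius G p < pSomborRadius (shift G u v M) p := by
  have hd : deg G v ≤ deg G u + M.card := by
    have h1 : Finset.univ.filter (G.Adj v) ⊆
        insert u ((Finset.univ.filter (G.Adj u)).erase a ∪ M) := by
      intro j hj
      have hj : G.Adj v j := by simpa using hj
      simp only [Finset.mem_insert, Finset.mem_union, Finset.mem_erase, Finset.mem_filter,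
        Finset.mem_univ, true_and]
      by_cases h1 : j = u
      · exact Or.inl h1
      by_cases h2 : G.Adj u j
      · exact Or.inr (Or.inl ⟨fun e => hva (e ▸ hj), h2⟩)
      · exact Or.inr (Or.inr (hM j hj h2 h1))
    have h2 := Finset.card_le_card h1
    have h3 := Finset.card_insert_le u ((Finset.univ.filter (G.Adj u)).erase a ∪ M)
    have h4 := Finset.card_union_le ((Finset.univ.filter (G.Adj u)).erase a) M
    have h5 := Finset.card_erase_add_one (s := Finset.univ.filter (G.Adj u)) (a := a)
      (by simpa using hua)
    change (Finset.univ.filter (G.Adj v)).card ≤ (Finset.univ.filter (G.Adj u)).card + _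
    omega
  refine pSomborRadius_lt_shift hp h hx hS hd (Finset.sum_pos' (fun j hj => ?_) ⟨a, ?_, ?_⟩)
  · refine mul_nonneg ?_ (hx j).le
    have hjv := Finset.ne_of_mem_erase hj
    have hju := Finset.ne_of_mem_erase (Finset.mem_of_mem_erase hj)
    by_cases h1 : G.Adj u j <;> by_cases h2 : G.Adj v j
    · exact shiftGain_of_adj_adj hp h hx hxx hd h1 h2
    · exact (shiftGain_of_adj_left_pos (by linarith) h hx hne h1 h2 hjv).le
    · exact (shiftGain_of_mem hp h hx hxx hd (hM j h2 h1 hju)).1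
    · exact (shiftGain_of_not_adj h h1 h2).ge
  · simp [hav, hua.ne']
  · exact mul_pos (shiftGain_of_adj_left_pos (by linarith) h hx hne hua hva hav) (hx a)

open Classical in
/-- One step towards the extremal graphs: two vertices, neither of which has a neighbourhood
containing that of the other, allow a Kelmans transformation.  It creates no dominating vertex if
the two vertices are not adjacent, or if they have a common non-neighbour. -/
theorem exists_lt_of_incomparable (hp : 1 ≤ p) (hG : IsBicyclic G)
    (hdom : ∀ y, ∃ z, z ≠ y ∧ ¬ G.Adj y z) {a c : V} (huv : u ≠ v)
    (hua : G.Adj u a) (hva : ¬ G.Adj v a) (hav : a ≠ v)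
    (hvc : G.Adj v c) (huc : ¬ G.Adj u c) (hcu : c ≠ u)
    (hy : (G.Adj u v ∧ ∃ y, ¬ G.Adj u y ∧ ¬ G.Adj v y) ∨
      (¬ G.Adj u v ∧ ∃ w, G.Adj u w ∧ G.Adj v w)) :
    ∃ G' : SimpleGraph V, IsBicyclic G' ∧ (∀ y, ∃ z, z ≠ y ∧ ¬ G'.Adj y z) ∧
      pSomborRadius G p < pSomborRadius G' p := by
  obtain ⟨x, hx, hS⟩ := exists_perron_vector (p := p) hG.1
  wlog hxx : x v ≤ x u generalizing u v a c
  · refine this huv.symm hvc huc hcu hua hva hav ?_ (le_of_not_ge hxx)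
    rcases hy with ⟨h1, y, h2, h3⟩ | ⟨h1, w, h2, h3⟩
    · exact Or.inl ⟨h1.symm, y, h3, h2⟩
    · exact Or.inr ⟨fun h => h1 h.symm, w, h3, h2⟩
  have := hG.1.nonempty
  set M := Finset.univ.filter fun j => G.Adj v j ∧ ¬ G.Adj u j ∧ j ≠ u with hM
  have h : Shiftable G u v M := ⟨huv, fun m hm => by simpa [hM] using hm⟩
  have hcM : c ∈ M := by simp [hM, hvc, huc, hcu]
  refine ⟨shift G u v M, isBicyclic_shift hG h ?_, fun y => ?_, pSomborRadius_lt_kelmans hp h hx hS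
    hxx (fun j h1 h2 h3 => by simp [hM, h1, h2, h3]) ⟨c, hcM⟩ hua hva hav⟩
  · rcases hy with ⟨h1, _⟩ | ⟨_, h1⟩
    · exact Or.inl h1
    · exact Or.inr h1
  · by_cases hyu : y = u
    · subst hyu
      rcases hy with ⟨h1, z, h2, h3⟩ | ⟨h1, _⟩
      · refine ⟨z, fun e => h3 (e ▸ h1.symm), fun hz => ?_⟩
        rcases (shift_adj_left h).1 hz with h4 | h4
        · exact h2 h4
        · exact h3 (h.2 z h4).1
      · exact ⟨v, huv.symm, fun hz => ((shift_adj_left h).1 hz).elim h1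
          fun hv => h.ne_right hv rfl⟩
    by_cases hyv : y = v
    · subst hyv
      exact ⟨c, hvc.ne', fun hz => ((shift_adj_right h).1 hz).2 hcM⟩
    by_cases hyM : y ∈ M
    · exact ⟨v, fun e => hyv e.symm, fun hz => ((shift_adj_right h).1 hz.symm).2 hyM⟩
    · obtain ⟨z, hz, hyz⟩ := hdom y
      refine ⟨z, hz, fun hz' => ?_⟩
      rcases (shift_adj h).1 hz' with h4 | h4 | h4
      · exact hyz h4.1
      · exact hyu h4.1
      · exact hyM h4.2

end Quadratic

/-! ### Recognizing `B₁`, `B₂` and `B₃` -/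

section Recognition

variable {V : Type*} [Fintype V] {G : SimpleGraph V} {n : ℕ}

theorem exists_equiv_fin_extending (hV : Fintype.card V = n) {k : ℕ} {l : Fin k → V}
    (hl : Function.Injective l) : ∃ e : V ≃ Fin n, ∀ i, (e (l i)).val = i.val := by
  classical
  have hk : k ≤ n := by simpa [hV] using Fintype.card_le_of_injective l hl
  let e₀ := Fintype.equivFinOfCardEq hV
  obtain ⟨σ, hσ⟩ := Equiv.Perm.exists_extending_pair (e₀ ∘ l) (Fin.castLE hk)
    (e₀.injective.comp hl) (Fin.castLE_injective hk)
  exact ⟨e₀.trans σ, fun i => by simpa using congrArg Fin.val (hσ i)⟩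

/-- Two bicyclic graphs, having equally many edges, are isomorphic if some bijection of their
vertices maps the edges of one of them to edges of the other. -/
theorem nonempty_iso_of_adj (hG : IsBicyclic G) {H : SimpleGraph (Fin n)} (hH : IsBicyclic H)
    (e : V ≃ Fin n) (h : ∀ i j, H.Adj (e i) (e j) → G.Adj i j) : Nonempty (G ≃g H) := by
  classical
  have hle : H.comap e ≤ G := fun i j hij => h i j hij
  let φ : H.comap e ≃g H := SimpleGraph.Iso.comap e H
  have hcard : Nat.card (H.comap e).edgeSet = Nat.card G.edgeSet := by
    rw [Nat.card_congr φ.mapEdgeSet, hG.2, hH.2, Fintype.card_congr e]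
  have : H.comap e = G := by
    rw [← SimpleGraph.edgeSet_inj]
    refine Set.eq_of_subset_of_ncard_le (SimpleGraph.edgeSet_mono hle) ?_
    rw [← Nat.card_coe_set_eq, ← Nat.card_coe_set_eq, hcard]
  exact ⟨this ▸ φ⟩

/-- Every bicyclic graph with a dominating vertex `u` and a path `b a c` that avoids `u` is `B₁`. -/
theorem nonempty_iso_graphB1 (hV : Fintype.card V = n) (hG : IsBicyclic G)
    (hB : IsBicyclic (graphB1 n)) {u a b c : V} (hu : ∀ j, j ≠ u → G.Adj u j) (hau : a ≠ u)
    (hbu : b ≠ u) (hcu : c ≠ u) (hbc : b ≠ c) (hab : G.Adj a b) (hac : G.Adj a c) :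
    Nonempty (G ≃g graphB1 n) := by
  have hl : Function.Injective ![u, a, b, c] := by
    have := hab.ne; have := hac.ne
    intro i j; fin_cases i <;> fin_cases j <;> simp <;> grind
  obtain ⟨e, he⟩ := exists_equiv_fin_extending hV hl
  simp only [Fin.forall_fin_succ, Fin.forall_fin_zero] at he
  simp at he
  have inv : ∀ x y : V, (e x).val = (e y).val → x = y := fun x y h => e.injective (Fin.ext h)
  refine nonempty_iso_of_adj hG hB e fun i j hij => ?_
  simp only [graphB1, SimpleGraph.fromRel_adj] at hij
  grind [SimpleGraph.adj_comm]

/-- Every bicyclic graph with a dominating vertex `u` and two disjoint edges that avoid `u` is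
`B₂`. -/
theorem nonempty_iso_graphB2 (hV : Fintype.card V = n) (hG : IsBicyclic G)
    (hB : IsBicyclic (graphB2 n)) {u a b c d : V} (hu : ∀ j, j ≠ u → G.Adj u j) (hau : a ≠ u)
    (hbu : b ≠ u) (hcu : c ≠ u) (hdu : d ≠ u) (hac : a ≠ c) (had : a ≠ d) (hbc : b ≠ c)
    (hbd : b ≠ d) (hab : G.Adj a b) (hcd : G.Adj c d) : Nonempty (G ≃g graphB2 n) := by
  have hl : Function.Injective ![u, a, b, c, d] := by
    have := hab.ne; have := hcd.ne
    intro i j; fin_cases i <;> fin_cases j <;> simp <;> grind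
  obtain ⟨e, he⟩ := exists_equiv_fin_extending hV hl
  simp only [Fin.forall_fin_succ, Fin.forall_fin_zero] at he
  simp at he
  have inv : ∀ x y : V, (e x).val = (e y).val → x = y := fun x y h => e.injective (Fin.ext h)
  refine nonempty_iso_of_adj hG hB e fun i j hij => ?_
  simp only [graphB2, SimpleGraph.fromRel_adj] at hij
  grind [SimpleGraph.adj_comm]

/-- A bicyclic graph is `B₃` if `u` is adjacent to all other vertices but `c`, and some vertex `v`
is adjacent to `c` and to two vertices besides `u` and `c`. -/
theorem nonempty_iso_graphB3 (hV : Fintype.card V = n) (hG : IsBicyclic G)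
    (hB : IsBicyclic (graphB3 n)) {u v a b c : V} (hu : ∀ j, j ≠ u → j ≠ c → G.Adj u j)
    (hvu : v ≠ u) (hau : a ≠ u) (hbu : b ≠ u) (hcu : c ≠ u) (hab : a ≠ b) (hac : a ≠ c)
    (hbc : b ≠ c) (hva : G.Adj v a) (hvb : G.Adj v b) (hvc : G.Adj v c) :
    Nonempty (G ≃g graphB3 n) := by
  have hl : Function.Injective ![u, v, a, b, c] := by
    have := hva.ne; have := hvb.ne; have := hvc.ne
    intro i j; fin_cases i <;> fin_cases j <;> simp <;> grind
  obtain ⟨e, he⟩ := exists_equiv_fin_extending hV hl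
  simp only [Fin.forall_fin_succ, Fin.forall_fin_zero] at he
  simp at he
  have inv : ∀ x y : V, (e x).val = (e y).val → x = y := fun x y h => e.injective (Fin.ext h)
  refine nonempty_iso_of_adj hG hB e fun i j hij => ?_
  simp only [graphB3, SimpleGraph.fromRel_adj] at hij
  have hi := hu i
  have hj := hu j
  by_cases i = u <;> by_cases j = u <;> by_cases i = c <;> by_cases j = c <;>
    grind [SimpleGraph.adj_comm]

end Recognition

section Models

variable {n : ℕ}

theorem graphB2_adj {i j : Fin n} : (graphB2 n).Adj i j ↔ i ≠ j ∧ (i.val = 0 ∨ j.val = 0 ∨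
    (i.val = 1 ∧ j.val = 2) ∨ (i.val = 2 ∧ j.val = 1) ∨ (i.val = 3 ∧ j.val = 4) ∨
    (i.val = 4 ∧ j.val = 3)) := by
  simp only [graphB2, SimpleGraph.fromRel_adj]
  tauto

theorem graphB3_adj {i j : Fin n} : (graphB3 n).Adj i j ↔ i ≠ j ∧
    ((i.val = 0 ∧ j.val ≠ 4) ∨ (i.val ≠ 4 ∧ j.val = 0) ∨
    (i.val = 1 ∧ (j.val = 2 ∨ j.val = 3 ∨ j.val = 4)) ∨
    (j.val = 1 ∧ (i.val = 2 ∨ i.val = 3 ∨ i.val = 4))) := by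
  simp only [graphB3, SimpleGraph.fromRel_adj]
  tauto

/-- The degrees of `B₂`, as a function of the index of the vertex. -/
def degB2 (n k : ℕ) : ℕ := if k = 0 then n - 1 else if k = 1 ∨ k = 2 ∨ k = 3 ∨ k = 4 then 2 else 1

/-- The degrees of `B₃`, as a function of the index of the vertex. -/
def degB3 (n k : ℕ) : ℕ :=
  if k = 0 then n - 2 else if k = 1 then 4 else if k = 2 ∨ k = 3 then 2 else 1

theorem deg_graphB2 (hn : 6 ≤ n) (i : Fin n) : deg (graphB2 n) i = degB2 n i.val := by
  classical
  have key : ∀ s : Finset (Fin n), (∀ j, (graphB2 n).Adj i j ↔ j ∈ s) →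
      deg (graphB2 n) i = s.card := fun s hs => by rw [deg]; congr 1; ext j; simp [hs]
  have main : i.val = 0 ∨ i.val = 1 ∨ i.val = 2 ∨ i.val = 3 ∨ i.val = 4 ∨ 5 ≤ i.val := by omega
  rcases main with h | h | h | h | h | h
  · rw [key (Finset.univ.erase i) fun j => ?_, Finset.card_erase_of_mem (Finset.mem_univ _)]
    · simp [degB2, h]
    · simp only [graphB2_adj, Finset.mem_erase, Finset.mem_univ, and_true]; grind
  · rw [key {⟨0, by omega⟩, ⟨2, by omega⟩} fun j => ?_, Finset.card_pair (by simp)]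
    · simp [degB2, h]
    · simp only [graphB2_adj, Finset.mem_insert, Finset.mem_singleton, Fin.ext_iff]; omega
  · rw [key {⟨0, by omega⟩, ⟨1, by omega⟩} fun j => ?_, Finset.card_pair (by simp)]
    · simp [degB2, h]
    · simp only [graphB2_adj, Finset.mem_insert, Finset.mem_singleton, Fin.ext_iff]; omega
  · rw [key {⟨0, by omega⟩, ⟨4, by omega⟩} fun j => ?_, Finset.card_pair (by simp)]
    · simp [degB2, h]
    · simp only [graphB2_adj, Finset.mem_insert, Finset.mem_singleton, Fin.ext_iff]; omega
  · rw [key {⟨0, by omega⟩, ⟨3, by omega⟩} fun j => ?_, Finset.card_pair (by simp)]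
    · simp [degB2, h]
    · simp only [graphB2_adj, Finset.mem_insert, Finset.mem_singleton, Fin.ext_iff]; omega
  · rw [key {⟨0, by omega⟩} fun j => ?_, Finset.card_singleton]
    · rw [degB2, if_neg (by omega), if_neg (by omega)]
    · simp only [graphB2_adj, Finset.mem_singleton, Fin.ext_iff]; omega

theorem deg_graphB3 (hn : 6 ≤ n) (i : Fin n) : deg (graphB3 n) i = degB3 n i.val := by
  classical
  have key : ∀ s : Finset (Fin n), (∀ j, (graphB3 n).Adj i j ↔ j ∈ s) →
      deg (graphB3 n) i = s.card := fun s hs => by rw [deg]; congr 1; ext j; simp [hs]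
  have main : i.val = 0 ∨ i.val = 1 ∨ i.val = 2 ∨ i.val = 3 ∨ i.val = 4 ∨ 5 ≤ i.val := by omega
  rcases main with h | h | h | h | h | h
  · rw [key ((Finset.univ.erase i).erase ⟨4, by omega⟩) fun j => ?_, Finset.card_erase_of_mem,
      Finset.card_erase_of_mem (Finset.mem_univ _)]
    · simp [degB3, h]; omega
    · simp only [Finset.mem_erase, ne_eq, Fin.ext_iff, Finset.mem_univ, and_true]; omega
    · simp only [graphB3_adj, Finset.mem_erase, Finset.mem_univ, and_true, ne_eq,
        Fin.ext_iff]
      omega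
  · rw [key {⟨0, by omega⟩, ⟨2, by omega⟩, ⟨3, by omega⟩, ⟨4, by omega⟩} fun j => ?_]
    · simp [degB3, h, Finset.card_insert_of_notMem]
    · simp only [graphB3_adj, Finset.mem_insert, Finset.mem_singleton, Fin.ext_iff]; omega
  · rw [key {⟨0, by omega⟩, ⟨1, by omega⟩} fun j => ?_, Finset.card_pair (by simp)]
    · simp [degB3, h]
    · simp only [graphB3_adj, Finset.mem_insert, Finset.mem_singleton, Fin.ext_iff]; omega
  · rw [key {⟨0, by omega⟩, ⟨1, by omega⟩} fun j => ?_, Finset.card_pair (by simp)]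
    · simp [degB3, h]
    · simp only [graphB3_adj, Finset.mem_insert, Finset.mem_singleton, Fin.ext_iff]; omega
  · rw [key {⟨1, by omega⟩} fun j => ?_, Finset.card_singleton]
    · simp [degB3, h]
    · simp only [graphB3_adj, Finset.mem_singleton, Fin.ext_iff]; omega
  · rw [key {⟨0, by omega⟩} fun j => ?_, Finset.card_singleton]
    · rw [degB3, if_neg (by omega), if_neg (by omega), if_neg (by omega)]
    · simp only [graphB3_adj, Finset.mem_singleton, Fin.ext_iff]; omega

theorem isBicyclic_graphB2 (hn : 6 ≤ n) : IsBicyclic (graphB2 n) := by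
  have h0 : ∀ j : Fin n, (graphB2 n).Reachable ⟨0, by omega⟩ j := fun j => by
    by_cases hj : j.val = 0
    · rw [show j = ⟨0, by omega⟩ from Fin.ext hj]
    · exact (graphB2_adj.2 ⟨fun e => hj (by simp [← e]), Or.inl rfl⟩).reachable
  refine ⟨(SimpleGraph.connected_iff _).2
    ⟨fun i j => (h0 i).symm.trans (h0 j), ⟨⟨0, by omega⟩⟩⟩, ?_⟩
  refine Nat.eq_of_mul_eq_mul_left two_pos ?_
  rw [← sum_deg, Fintype.card_fin, Finset.sum_congr rfl fun i _ => deg_graphB2 hn i,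
    Fin.sum_univ_eq_sum_range (degB2 n)]
  obtain ⟨m, rfl⟩ := Nat.exists_eq_add_of_le' hn
  simp [Finset.sum_range_succ', degB2]
  omega

theorem shiftable_graphB2 (hn : 6 ≤ n) : Shiftable (graphB2 n) ⟨1, by omega⟩ ⟨4, by omega⟩
    {⟨3, by omega⟩} := by
  simp [Shiftable, graphB2_adj]

theorem shift_graphB2 (hn : 6 ≤ n) :
    shift (graphB2 n) ⟨1, by omega⟩ ⟨4, by omega⟩ {⟨3, by omega⟩} = graphB1 n := by
  ext i j
  rw [shift_adj (shiftable_graphB2 hn)]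
  simp only [graphB2_adj, graphB1, SimpleGraph.fromRel_adj, Finset.mem_singleton, ne_eq,
    Fin.ext_iff]
  omega

theorem isBicyclic_graphB1 (hn : 6 ≤ n) : IsBicyclic (graphB1 n) := by
  rw [← shift_graphB2 hn]
  refine isBicyclic_shift (isBicyclic_graphB2 hn) (shiftable_graphB2 hn)
    (Or.inr ⟨⟨0, by omega⟩, ?_⟩)
  simp [graphB2_adj]

theorem isBicyclic_graphB3 (hn : 6 ≤ n) : IsBicyclic (graphB3 n) := by
  have h : Shiftable (graphB1 n) ⟨1, by omega⟩ ⟨0, by omega⟩ {⟨4, by omega⟩} := by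
    simp [Shiftable, graphB1]
  have e : shift (graphB1 n) ⟨1, by omega⟩ ⟨0, by omega⟩ {⟨4, by omega⟩} = graphB3 n := by
    ext i j
    rw [shift_adj h]
    simp only [graphB3_adj, graphB1, SimpleGraph.fromRel_adj, Finset.mem_singleton, ne_eq,
      Fin.ext_iff]
    omega
  rw [← e]
  refine isBicyclic_shift (isBicyclic_graphB1 hn) h (Or.inl ?_)
  simp [graphB1]

end Models

/-! ### Bicyclic graphs without improving Kelmans transformation -/

section Classification

variable {V : Type*} {G : SimpleGraph V}

/-- If every vertex but `u` is assigned a neighbour, its parent, and no two vertices are parents of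
each other, then all edges of a bicyclic graph but two join a vertex to its parent. -/
theorem IsBicyclic.exists_extra_edges [Fintype V] (hG : IsBicyclic G) (u : V) (f : V → V)
    (hf : ∀ j, j ≠ u → G.Adj j (f j))
    (hff : ∀ j k, j ≠ u → k ≠ u → j = f k → k ≠ f j) :
    ∃ a b c d : V, G.Adj a b ∧ G.Adj c d ∧ s(a, b) ≠ s(c, d) ∧
      (∀ j, j ≠ u → s(a, b) ≠ s(j, f j) ∧ s(c, d) ≠ s(j, f j)) ∧
      ∀ i j, G.Adj i j → (∃ k, k ≠ u ∧ s(i, j) = s(k, f k)) ∨ s(i, j) = s(a, b) ∨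
        s(i, j) = s(c, d) := by
  classical
  set T : Finset (Sym2 V) := (Finset.univ.erase u).image fun j => s(j, f j) with hT
  have hTc : T.card = Fintype.card V - 1 := by
    rw [hT, Finset.card_image_of_injOn, Finset.card_erase_of_mem (Finset.mem_univ u),
      Finset.card_univ]
    intro j hj k hk hjk
    have hj := Finset.ne_of_mem_erase hj
    have hk := Finset.ne_of_mem_erase hk
    rcases Sym2.eq_iff.1 hjk with h | h
    · exact h.1
    · exact (hff j k hj hk h.1 h.2.symm).elim
  have hTG : T ⊆ G.edgeFinset := by
    intro e he
    obtain ⟨j, hj, rfl⟩ := Finset.mem_image.1 he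
    simpa using hf j (Finset.ne_of_mem_erase hj)
  have hcard : G.edgeFinset.card = Fintype.card V + 1 := by
    rw [← hG.2, ← G.coe_edgeFinset, Nat.card_coe_set_eq, Set.ncard_coe_finset]
  have hpos : 0 < Fintype.card V := Fintype.card_pos_iff.2 ⟨u⟩
  have h2 : (G.edgeFinset \ T).card = 2 := by
    rw [Finset.card_sdiff_of_subset hTG]; omega
  obtain ⟨e₁, e₂, hne, he⟩ := Finset.card_eq_two.1 h2
  have mem : ∀ e, e ∈ G.edgeFinset \ T ↔ e = e₁ ∨ e = e₂ := fun e => by rw [he]; simp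
  have hT' : ∀ e ∉ T, ∀ j, j ≠ u → e ≠ s(j, f j) := by
    rintro e h j hj rfl
    exact h (Finset.mem_image.2 ⟨j, by simpa using hj, rfl⟩)
  induction e₁ with | h a b => ?_
  induction e₂ with | h c d => ?_
  have h₁ := Finset.mem_sdiff.1 ((mem s(a, b)).2 (Or.inl rfl))
  have h₂ := Finset.mem_sdiff.1 ((mem s(c, d)).2 (Or.inr rfl))
  refine ⟨a, b, c, d, by simpa using h₁.1, by simpa using h₂.1, hne,
    fun j hj => ⟨hT' _ h₁.2 j hj, hT' _ h₂.2 j hj⟩, fun i j hij => ?_⟩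
  by_cases h : s(i, j) ∈ T
  · obtain ⟨k, hk, e⟩ := Finset.mem_image.1 h
    exact Or.inl ⟨k, Finset.ne_of_mem_erase hk, e.symm⟩
  · exact Or.inr ((mem _).1 (Finset.mem_sdiff.2 ⟨by simpa using hij, h⟩))

/-- The two edges outside the star at a dominating vertex either share an end or are disjoint. -/
theorem IsBicyclic.iso_of_dominating [Fintype V] {n : ℕ} (hn : 6 ≤ n) (hV : Fintype.card V = n)
    (hG : IsBicyclic G) {u : V} (hu : ∀ j, j ≠ u → G.Adj u j) :
    Nonempty (G ≃g graphB1 n) ∨ Nonempty (G ≃g graphB2 n) := by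
  obtain ⟨a, b, c, d, hab, hcd, hne, hT, -⟩ := hG.exists_extra_edges u (fun _ => u)
    (fun j hj => (hu j hj).symm) (fun j k hj _ h => (hj h).elim)
  have hau : a ≠ u := by
    rintro rfl; exact (hT b hab.ne').1 Sym2.eq_swap
  have hbu : b ≠ u := by
    rintro rfl; exact (hT a hab.ne).1 rfl
  have hcu : c ≠ u := by
    rintro rfl; exact (hT d hcd.ne').2 Sym2.eq_swap
  have hdu : d ≠ u := by
    rintro rfl; exact (hT c hcd.ne).2 rfl
  have hne' := mt Sym2.eq_iff.2 hne
  have h1 := isBicyclic_graphB1 hn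
  by_cases hac : a = c
  · subst hac
    exact Or.inl (nonempty_iso_graphB1 hV hG h1 hu hau hbu hdu (by grind) hab hcd)
  by_cases had : a = d
  · subst had
    exact Or.inl (nonempty_iso_graphB1 hV hG h1 hu hau hbu hcu (by grind) hab hcd.symm)
  by_cases hbc : b = c
  · subst hbc
    exact Or.inl (nonempty_iso_graphB1 hV hG h1 hu hbu hau hdu (by grind) hab.symm hcd)
  by_cases hbd : b = d
  · subst hbd
    exact Or.inl (nonempty_iso_graphB1 hV hG h1 hu hbu hau hcu (by grind) hab.symm hcd.symm)
  exact Or.inr (nonempty_iso_graphB2 hV hG (isBicyclic_graphB2 hn) hu hau hbu hcu hdu hac had hbc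
    hbd hab hcd)

/-- Relative to an edge `u v` whose ends together dominate the graph, `i j` is an edge outside the
spanning tree that attaches the neighbours of `u` to `u` and all remaining vertices to `v`. -/
def ExtraEdge (G : SimpleGraph V) (u v i j : V) : Prop :=
  G.Adj i j ∧ ((i = v ∧ j ≠ u ∧ G.Adj u j) ∨ (j = v ∧ i ≠ u ∧ G.Adj u i) ∨
    (i ≠ u ∧ i ≠ v ∧ j ≠ u ∧ j ≠ v))

/-- `Spanning G u v`: the ends of the edge `u v` together dominate the graph. -/
def Spanning (G : SimpleGraph V) (u v : V) : Prop :=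
  G.Adj u v ∧ ∀ y, G.Adj u y ∨ G.Adj v y

theorem Spanning.symm {u v : V} (h : Spanning G u v) : Spanning G v u :=
  ⟨h.1.symm, fun y => (h.2 y).symm⟩

/-- A bicyclic graph has exactly two extra edges. -/
theorem IsBicyclic.extraEdge_pair [Fintype V] (hG : IsBicyclic G) {u v : V} (h : Spanning G u v) :
    ∃ a b c d : V, ExtraEdge G u v a b ∧ ExtraEdge G u v c d ∧ s(a, b) ≠ s(c, d) ∧
      ∀ i j, ExtraEdge G u v i j → s(i, j) = s(a, b) ∨ s(i, j) = s(c, d) := by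
  classical
  have huv := h.1.ne
  set f : V → V := fun j => if j = v ∨ G.Adj u j then u else v with hf
  have hfT : ∀ i j, G.Adj i j → (∀ k, k ≠ u → s(i, j) ≠ s(k, f k)) → ExtraEdge G u v i j := by
    intro i j hij hk
    have h1 := hk i
    have h2 := hk j
    simp only [hf, ne_eq, Sym2.eq_iff] at h1 h2
    refine ⟨hij, ?_⟩
    have h3 := h.2 i
    have h4 := h.2 j
    have h5 := hij.ne
    grind [SimpleGraph.adj_comm]
  obtain ⟨a, b, c, d, hab, hcd, hne, hT, hall⟩ := hG.exists_extra_edges u f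
    (fun j hj => by
      simp only [hf]
      split_ifs with h1
      · rcases h1 with rfl | h1
        · exact h.1.symm
        · exact h1.symm
      · exact ((h.2 j).resolve_left fun h2 => h1 (Or.inr h2)).symm)
    (fun j k hj hk h1 h2 => by
      have := h.1
      simp only [hf] at h1 h2
      grind)
  refine ⟨a, b, c, d, hfT a b hab fun k hk => (hT k hk).1, hfT c d hcd fun k hk => (hT k hk).2, hne,
    fun i j hij => (hall i j hij.1).resolve_left ?_⟩
  rintro ⟨k, hk, e⟩
  have h1 := hij.2
  have := h.1
  have hi := hij.1.ne
  simp only [hf, Sym2.eq_iff] at e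
  grind

/-- Among any three extra edges two coincide. -/
theorem IsBicyclic.extraEdge_eq [Fintype V] (hG : IsBicyclic G) {u v : V} (h : Spanning G u v)
    {i j k l m o : V} (h1 : ExtraEdge G u v i j) (h2 : ExtraEdge G u v k l)
    (h3 : ExtraEdge G u v m o) : s(i, j) = s(k, l) ∨ s(i, j) = s(m, o) ∨ s(k, l) = s(m, o) := by
  obtain ⟨a, b, c, d, -, -, -, hall⟩ := hG.extraEdge_pair h
  have := hall _ _ h1
  have := hall _ _ h2
  have := hall _ _ h3
  grind

/-- Any two non-adjacent vertices with a common neighbour have nested neighbourhoods. -/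
def NestedAtDistanceTwo (G : SimpleGraph V) : Prop :=
  ∀ u v w a c, ¬ G.Adj u v → G.Adj u w → G.Adj v w → G.Adj u a → ¬ G.Adj v a → G.Adj v c →
    G.Adj u c

/-- Any two adjacent vertices have nested neighbourhoods or dominate the graph. -/
def NestedOrSpanning (G : SimpleGraph V) : Prop :=
  ∀ u v a c, G.Adj u v → G.Adj u a → ¬ G.Adj v a → a ≠ v → G.Adj v c → ¬ G.Adj u c → c ≠ u →
    Spanning G u v

/-- `K₄` minus the edge `d e`, with pendent vertices at its vertices `u`, `v` of degree three. -/
structure IsDoubleBroom (G : SimpleGraph V) (u v d e : V) : Prop where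
  adj : G.Adj u v
  ne : d ≠ e
  adj_d : ∀ k, G.Adj d k ↔ k = u ∨ k = v
  adj_e : ∀ k, G.Adj e k ↔ k = u ∨ k = v
  pendant : ∀ j, j ≠ u → j ≠ v → j ≠ d → j ≠ e → (∀ k, G.Adj j k ↔ k = u) ∨
    (∀ k, G.Adj j k ↔ k = v)

/-- `K₄` minus the edge `v a`, with pendent vertices at `v`; the vertices of degree three are `u`
and `w`. -/
structure IsKite (G : SimpleGraph V) (v u w a : V) : Prop where
  adj_uw : G.Adj u w
  adj_vu : G.Adj v u
  adj_vw : G.Adj v w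
  ne : a ≠ v
  adj_a : ∀ k, G.Adj a k ↔ k = u ∨ k = w
  adj_u : ∀ k, G.Adj u k ↔ k = v ∨ k = w ∨ k = a
  adj_w : ∀ k, G.Adj w k ↔ k = v ∨ k = u ∨ k = a
  pendant : ∀ j, j ≠ v → j ≠ u → j ≠ w → j ≠ a → ∀ k, G.Adj j k ↔ k = v

section Cases

variable [Fintype V] {u v : V}

/-- The set of vertices adjacent to `u` but not to `v` is independent: an edge inside it would
force three extra edges. -/
theorem IsBicyclic.not_adj_of_private (hG : IsBicyclic G) (h : Spanning G u v)
    (hN : NestedAtDistanceTwo G) {i j c : V} (hvc : G.Adj v c)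
    (huc : ¬ G.Adj u c) (hcu : c ≠ u) (hui : G.Adj u i) (hvi : ¬ G.Adj v i) (hiv : i ≠ v)
    (huj : G.Adj u j) (hvj : ¬ G.Adj v j) (hjv : j ≠ v) : ¬ G.Adj i j := by
  intro hij
  have hic := hN i v u j c (fun e => hvi e.symm) hui.symm h.1.symm hij hvj hvc
  have hjc := hN j v u i c (fun e => hvj e.symm) huj.symm h.1.symm hij.symm hvi hvc
  have e := hG.extraEdge_eq h (i := i) (j := j) (k := i) (l := c) (m := j) (o := c)
    ⟨hij, by grind [SimpleGraph.irrefl]⟩ ⟨hic, by grind [SimpleGraph.irrefl]⟩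
    ⟨hjc, by grind [SimpleGraph.irrefl]⟩
  simp only [Sym2.eq_iff] at e
  have := hij.ne
  grind

/-- If a common neighbour `w` of `u` and `v` is adjacent to a private neighbour `a` of `u`, then
`w v` and `w a` are the two extra edges. The neighbourhoods of `v` and `w` are incomparable, so `v w`
dominates the graph too, which leaves only pendent vertices at `v`. -/
theorem IsBicyclic.isKite_of_common_adj (hG : IsBicyclic G) (h : Spanning G u v)
    (hS : NestedOrSpanning G) {w a c : V} (huw : G.Adj u w) (hvw : G.Adj v w) (hua : G.Adj u a)
    (hva : ¬ G.Adj v a) (hav : a ≠ v) (haw : G.Adj a w) (hvc : G.Adj v c) (huc : ¬ G.Adj u c)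
    (hcu : c ≠ u) : IsKite G v u w a := by
  have hwv : ExtraEdge G u v w v := ⟨hvw.symm, Or.inr (Or.inl ⟨rfl, huw.ne', huw⟩)⟩
  have haw' : ExtraEdge G u v a w := ⟨haw, Or.inr (Or.inr ⟨hua.ne', hav, huw.ne', hvw.ne'⟩)⟩
  have only : ∀ i j, ExtraEdge G u v i j →
      (i = w ∧ j = v ∨ i = v ∧ j = w) ∨ (i = a ∧ j = w ∨ i = w ∧ j = a) := fun i j hij => by
    have e := hG.extraEdge_eq h hwv haw' hij
    simp only [Sym2.eq_iff] at e
    grind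
  have hwc : ¬ G.Adj w c := fun hwc => by
    have := only w c ⟨hwc, Or.inr (Or.inr ⟨huw.ne', hvw.ne', hcu, hvc.ne'⟩)⟩
    have := hvc.ne
    grind
  have hvw' := hS v w c a hvw hvc hwc (by grind) haw.symm hva hav
  have n1 := h.1.ne
  have n2 := huw.ne
  have n3 := hvw.ne
  have n4 := hua.ne
  have n5 := haw.ne
  have common : ∀ k, G.Adj u k → G.Adj v k → k = w := fun k h1 h2 => by
    have := only k v ⟨h2.symm, Or.inr (Or.inl ⟨rfl, h1.ne', h1⟩)⟩
    grind
  have rest : ∀ i j, G.Adj i j → i ≠ u → i ≠ v → j ≠ u → j ≠ v → i = a ∧ j = w ∨ i = w ∧ j = a :=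
    fun i j hij h1 h2 h3 h4 => by
      have := only i j ⟨hij, Or.inr (Or.inr ⟨h1, h2, h3, h4⟩)⟩
      grind
  have adj_u : ∀ k, G.Adj u k ↔ k = v ∨ k = w ∨ k = a := fun k => by
    refine ⟨fun hk => ?_, ?_⟩
    · rcases hvw'.2 k with h1 | h1
      · exact Or.inr (Or.inl (common k hk h1))
      · have := rest w k h1
        have := hk.ne
        grind
    · rintro (rfl | rfl | rfl) <;> [exact h.1; exact huw; exact hua]
  have adj_w : ∀ k, G.Adj w k ↔ k = v ∨ k = u ∨ k = a := fun k => by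
    refine ⟨fun hk => ?_, ?_⟩
    · have := rest w k hk
      grind
    · rintro (rfl | rfl | rfl) <;> [exact hvw.symm; exact huw.symm; exact haw.symm]
  refine ⟨huw, h.1.symm, hvw, hav, fun k => ⟨fun hk => ?_, ?_⟩, adj_u, adj_w,
    fun j h1 h2 h3 h4 k => ⟨fun hk => ?_, ?_⟩⟩
  · have := rest a k hk
    have : k ≠ v := fun e => hva (e ▸ hk.symm)
    grind
  · rintro (rfl | rfl) <;> [exact hua.symm; exact haw]
  · have := rest j k hk
    have := (adj_u j).1
    have := hk.symm
    grind
  · rintro rfl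
    have := (adj_w j).1
    exact ((hvw'.2 j).resolve_right (by grind)).symm

/-- If `u` and `v` have a common neighbour `w`, no edge `a c` joins their private parts: `w` and `a`
would be at distance two, and nestedness would produce a third extra edge. -/
theorem IsBicyclic.not_adj_of_common (hG : IsBicyclic G) (h : Spanning G u v)
    (hN : NestedAtDistanceTwo G) {w a c : V} (huw : G.Adj u w) (hvw : G.Adj v w) (hua : G.Adj u a)
    (hva : ¬ G.Adj v a) (hav : a ≠ v) (hvc : G.Adj v c) (huc : ¬ G.Adj u c)
    (hcu : c ≠ u) : ¬ G.Adj a c := by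
  intro hac
  have hwv : ExtraEdge G u v w v := ⟨hvw.symm, Or.inr (Or.inl ⟨rfl, huw.ne', huw⟩)⟩
  have hac' : ExtraEdge G u v a c := ⟨hac, Or.inr (Or.inr ⟨hua.ne', hav, hcu, hvc.ne'⟩)⟩
  have only : ∀ i j, i ≠ u → i ≠ v → j ≠ u → j ≠ v → G.Adj i j →
      (i = a ∧ j = c ∨ i = c ∧ j = a) := fun i j h1 h2 h3 h4 hij => by
    have e := hG.extraEdge_eq h hwv hac' ⟨hij, Or.inr (Or.inr ⟨h1, h2, h3, h4⟩)⟩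
    simp only [Sym2.eq_iff] at e
    grind
  have n2 := huw.ne
  have n3 := hvw.ne
  have n4 := hua.ne
  have hwa : ¬ G.Adj w a := fun hwa => by grind
  have hwc := hN w a u v c hwa huw.symm hua.symm hvw.symm (fun e => hva e.symm) hac
  have := only w c n2.symm n3.symm hcu hvc.ne' hwc
  grind

/-- The two extra edges do not form a path `c a d` from the private part of `u` to neighbours of
`v`: the edge `a c` would dominate the graph as well, which would then have only five vertices. -/
theorem IsBicyclic.false_of_path (hn : 6 ≤ Fintype.card V) (hG : IsBicyclic G)
    (h : Spanning G u v) (hS : NestedOrSpanning G)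
    {a c d : V} (hua : G.Adj u a) (hva : ¬ G.Adj v a) (hav : a ≠ v) (hvc : G.Adj v c)
    (huc : ¬ G.Adj u c) (hcu : c ≠ u) (hvd : G.Adj v d) (hdu : d ≠ u)
    (hac : G.Adj a c) (had : G.Adj a d) (hcd : c ≠ d) : False := by
  classical
  have hac' : ExtraEdge G u v a c := ⟨hac, Or.inr (Or.inr ⟨hua.ne', hav, hcu, hvc.ne'⟩)⟩
  have had' : ExtraEdge G u v a d := ⟨had, Or.inr (Or.inr ⟨hua.ne', hav, hdu, hvd.ne'⟩)⟩
  have only : ∀ i j, i ≠ u → i ≠ v → j ≠ u → j ≠ v → G.Adj i j →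
      (i = a ∧ j = c ∨ i = c ∧ j = a) ∨ (i = a ∧ j = d ∨ i = d ∧ j = a) :=
    fun i j h1 h2 h3 h4 hij => by
      have e := hG.extraEdge_eq h hac' had' ⟨hij, Or.inr (Or.inr ⟨h1, h2, h3, h4⟩)⟩
      simp only [Sym2.eq_iff] at e
      grind
  have hs := hS a c u v hac hua.symm (fun e => huc e.symm) hcu.symm hvc.symm
    (fun e => hva e.symm) hav.symm
  have hall : (Finset.univ : Finset V) ⊆ {u, v, a, c, d} := by
    intro y _
    simp only [Finset.mem_insert, Finset.mem_singleton]
    have n4 := hua.ne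
    have n5 := hvc.ne
    rcases hs.2 y with h1 | h1
    · have := only a y
      grind
    · have := only c y
      grind
  have h1 := Finset.card_le_card hall
  have h2 := Finset.card_le_five (a := u) (b := v) (c := a) (d := c) (e := d)
  rw [Finset.card_univ] at h1
  omega

/-- The two extra edges are not disjoint edges `a c` and `b d` from the private part of `u` to
neighbours of `v`: `a` and `b` would be at distance two, and nestedness would produce the third
extra edge `a d`. -/
theorem IsBicyclic.false_of_disjoint (hG : IsBicyclic G) (h : Spanning G u v)
    (hN : NestedAtDistanceTwo G) {a b c d : V} (hua : G.Adj u a) (hva : ¬ G.Adj v a) (hav : a ≠ v)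
    (hub : G.Adj u b) (hvb : ¬ G.Adj v b) (hbv : b ≠ v) (hvc : G.Adj v c) (hcu : c ≠ u)
    (huc : ¬ G.Adj u c)
    (hvd : G.Adj v d) (hdu : d ≠ u)
    (hac : G.Adj a c) (hbd : G.Adj b d) (hab : a ≠ b) (hcd : c ≠ d) : False := by
  have hac' : ExtraEdge G u v a c := ⟨hac, Or.inr (Or.inr ⟨hua.ne', hav, hcu, hvc.ne'⟩)⟩
  have hbd' : ExtraEdge G u v b d := ⟨hbd, Or.inr (Or.inr ⟨hub.ne', hbv, hdu, hvd.ne'⟩)⟩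
  have only : ∀ i j, i ≠ u → i ≠ v → j ≠ u → j ≠ v → G.Adj i j →
      (i = a ∧ j = c ∨ i = c ∧ j = a) ∨ (i = b ∧ j = d ∨ i = d ∧ j = b) :=
    fun i j h1 h2 h3 h4 hij => by
      have e := hG.extraEdge_eq h hac' hbd' ⟨hij, Or.inr (Or.inr ⟨h1, h2, h3, h4⟩)⟩
      simp only [Sym2.eq_iff] at e
      grind
  have n4 := hua.ne
  have n5 := hvc.ne
  have n6 := hub.ne
  have n7 := hvd.ne
  have hab' : ¬ G.Adj a b := hG.not_adj_of_private h hN hvc huc hcu hua hva hav hub hvb hbv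
  have hbc : ¬ G.Adj b c := fun e => by
    have := only b c
    grind
  have := hN a b u c d hab' hua.symm hub.symm hac hbc hbd
  have := only a d
  grind

/-- Two common neighbours `d`, `e` of `u` and `v` account for both extra edges. -/
theorem IsBicyclic.isDoubleBroom_of_common (hG : IsBicyclic G) (h : Spanning G u v) {d e : V}
    (hud : G.Adj u d) (hvd : G.Adj v d) (hue : G.Adj u e) (hve : G.Adj v e) (hde : d ≠ e) :
    IsDoubleBroom G u v d e := by
  have hd : ExtraEdge G u v d v := ⟨hvd.symm, Or.inr (Or.inl ⟨rfl, hud.ne', hud⟩)⟩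
  have he : ExtraEdge G u v e v := ⟨hve.symm, Or.inr (Or.inl ⟨rfl, hue.ne', hue⟩)⟩
  have n1 := h.1.ne
  have n2 := hud.ne
  have n3 := hvd.ne
  have n4 := hue.ne
  have n5 := hve.ne
  have only : ∀ i j, ExtraEdge G u v i j →
      (i = d ∧ j = v ∨ i = v ∧ j = d) ∨ (i = e ∧ j = v ∨ i = v ∧ j = e) := fun i j hij => by
    have e := hG.extraEdge_eq h hd he hij
    simp only [Sym2.eq_iff] at e
    grind
  have rest : ∀ i j, i ≠ u → i ≠ v → j ≠ u → j ≠ v → ¬ G.Adj i j := fun i j h1 h2 h3 h4 hij => by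
    have := only i j ⟨hij, Or.inr (Or.inr ⟨h1, h2, h3, h4⟩)⟩
    grind
  refine ⟨h.1, hde, fun k => ⟨fun hk => ?_, ?_⟩, fun k => ⟨fun hk => ?_, ?_⟩,
    fun j h1 h2 h3 h4 => ?_⟩
  · have := rest d k
    grind
  · rintro (rfl | rfl) <;> [exact hud.symm; exact hvd.symm]
  · have := rest e k
    grind
  · rintro (rfl | rfl) <;> [exact hue.symm; exact hve.symm]
  · have hj : ¬ (G.Adj u j ∧ G.Adj v j) := fun hj => by
      have := only j v ⟨hj.2.symm, Or.inr (Or.inl ⟨rfl, h1, hj.1⟩)⟩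
      grind
    have hr := fun k => rest j k h1 h2
    have := h.2 j
    by_cases hu : G.Adj u j
    · refine Or.inl fun k => ⟨fun hk => ?_, ?_⟩
      · have := hr k
        have := hk.symm
        grind
      · rintro rfl; exact hu.symm
    · refine Or.inr fun k => ⟨fun hk => ?_, ?_⟩
      · have := hr k
        have := hk.symm
        grind
      · rintro rfl; exact (this.resolve_left hu).symm

/-- A bicyclic graph with a spanning edge that admits no Kelmans transformation to a bicyclic graph
without dominating vertex is a double broom or a kite. The proof goes through the possible positions
of the two extra edges. -/
theorem IsBicyclic.doubleBroom_or_kite (hn : 6 ≤ Fintype.card V) (hG : IsBicyclic G)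
    (h : Spanning G u v) (hN : NestedAtDistanceTwo G) (hS : NestedOrSpanning G) {a c : V}
    (hua : G.Adj u a) (hva : ¬ G.Adj v a) (hav : a ≠ v) (hvc : G.Adj v c) (huc : ¬ G.Adj u c)
    (hcu : c ≠ u) : (∃ d e, IsDoubleBroom G u v d e) ∨ ∃ x y z t, IsKite G x y z t := by
  -- an extra edge that avoids `u` and `v` joins the private parts of `u` and `v`
  -- unless the graph is a kite
  have inner : ∀ i j, i ≠ u → i ≠ v → j ≠ u → j ≠ v → G.Adj i j →
      (∃ x y z t, IsKite G x y z t) ∨ (G.Adj u i ∧ G.Adj v i ∧ G.Adj u j ∧ G.Adj v j) ∨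
      (G.Adj u i ∧ ¬ G.Adj v i ∧ ¬ G.Adj u j ∧ G.Adj v j) ∨
      (¬ G.Adj u i ∧ G.Adj v i ∧ G.Adj u j ∧ ¬ G.Adj v j) := by
    intro i j hiu hiv hju hjv hij
    have cases : ∀ y, (G.Adj u y ∧ G.Adj v y) ∨ (G.Adj u y ∧ ¬ G.Adj v y) ∨
        (¬ G.Adj u y ∧ G.Adj v y) := fun y => by have := h.2 y; tauto
    rcases cases i with ⟨ui, vi⟩ | ⟨ui, vi⟩ | ⟨ui, vi⟩ <;>
      rcases cases j with ⟨uj, vj⟩ | ⟨uj, vj⟩ | ⟨uj, vj⟩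
    · exact Or.inr (Or.inl ⟨ui, vi, uj, vj⟩)
    · exact Or.inl ⟨_, _, _, _,
        hG.isKite_of_common_adj h hS ui vi uj vj hjv hij.symm hvc huc hcu⟩
    · exact Or.inl ⟨_, _, _, _,
        hG.isKite_of_common_adj h.symm hS vi ui vj uj hju hij.symm hua hva hav⟩
    · exact Or.inl ⟨_, _, _, _,
        hG.isKite_of_common_adj h hS uj vj ui vi hiv hij hvc huc hcu⟩
    · exact (hG.not_adj_of_private h hN hvc huc hcu ui vi hiv uj vj hjv hij).elim
    · exact Or.inr (Or.inr (Or.inl ⟨ui, vi, uj, vj⟩))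
    · exact Or.inl ⟨_, _, _, _,
        hG.isKite_of_common_adj h.symm hS vj uj vi ui hiu hij hua hva hav⟩
    · exact Or.inr (Or.inr (Or.inr ⟨ui, vi, uj, vj⟩))
    · exact (hG.not_adj_of_private h.symm hN hua hva hav vi ui hiu vj uj hju hij).elim
  -- the two extra edges, each oriented from `u` to `v` where that makes sense
  have kind : ∀ i j, ExtraEdge G u v i j → (∃ x y z t, IsKite G x y z t) ∨
      (∃ d, G.Adj u d ∧ G.Adj v d ∧ s(i, j) = s(d, v)) ∨
      ∃ k l, G.Adj u k ∧ ¬ G.Adj v k ∧ k ≠ v ∧ ¬ G.Adj u l ∧ G.Adj v l ∧ l ≠ u ∧ G.Adj k l ∧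
        s(i, j) = s(k, l) := by
    rintro i j ⟨hij, ⟨rfl, hju, hj⟩ | ⟨rfl, hiu, hi⟩ | ⟨hiu, hiv, hju, hjv⟩⟩
    · exact Or.inr (Or.inl ⟨j, hj, hij, Sym2.eq_swap⟩)
    · exact Or.inr (Or.inl ⟨i, hi, hij.symm, rfl⟩)
    · rcases inner i j hiu hiv hju hjv hij with hK | ⟨ui, vi, uj, vj⟩ | ⟨ui, vi, uj, vj⟩ |
        ⟨ui, vi, uj, vj⟩
      · exact Or.inl hK
      · have e := hG.extraEdge_eq h (i := i) (j := j) (k := i) (l := v) (m := j) (o := v)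
          ⟨hij, Or.inr (Or.inr ⟨hiu, hiv, hju, hjv⟩)⟩ ⟨vi.symm, Or.inr (Or.inl ⟨rfl, hiu, ui⟩)⟩
          ⟨vj.symm, Or.inr (Or.inl ⟨rfl, hju, uj⟩)⟩
        simp only [Sym2.eq_iff] at e
        have := hij.ne
        grind
      · exact Or.inr (Or.inr ⟨i, j, ui, vi, hiv, uj, vj, hju, hij, rfl⟩)
      · exact Or.inr (Or.inr ⟨j, i, uj, vj, hjv, ui, vi, hiu, hij.symm, Sym2.eq_swap⟩)
  obtain ⟨i, j, k, l, h1, h2, hne, -⟩ := hG.extraEdge_pair h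
  rcases kind i j h1 with hK | ⟨d, ud, vd, e1⟩ | ⟨a', c', ua, va, av, uc, vc, cu, ac, e1⟩
  · exact Or.inr hK
  · rcases kind k l h2 with hK | ⟨e, ue, ve, e2⟩ | ⟨a', c', ua, va, av, uc, vc, cu, ac, e2⟩
    · exact Or.inr hK
    · refine Or.inl ⟨d, e, hG.isDoubleBroom_of_common h ud vd ue ve ?_⟩
      rintro rfl
      exact hne (e1.trans e2.symm)
    · exact (hG.not_adj_of_common h hN ud vd ua va av vc uc cu ac).elim
  · rcases kind k l h2 with hK | ⟨e, ue, ve, e2⟩ | ⟨b, d, ub, vb, bv, ud, vd, du, bd, e2⟩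
    · exact Or.inr hK
    · exact (hG.not_adj_of_common h hN ue ve ua va av vc uc cu ac).elim
    · exfalso
      by_cases hab : a' = b
      · subst hab
        refine hG.false_of_path hn h hS ua va av vc uc cu vd du ac bd ?_
        rintro rfl
        exact hne (e1.trans e2.symm)
      by_cases hcd : c' = d
      · subst hcd
        exact hG.false_of_path hn h.symm hS vc uc cu ua va av ub bv ac.symm bd.symm hab
      · exact hG.false_of_disjoint h hN ua va av ub vb bv vc cu uc vd du ac bd hab hcd

end Cases

/-- A vertex of maximal degree that does not dominate the graph belongs to an edge whose ends have
incomparable neighbourhoods. -/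
theorem exists_incomparable_edge [Fintype V] [Nonempty V] (hG : G.Connected)
    (hdom : ∀ y, ∃ z, z ≠ y ∧ ¬ G.Adj y z) : ∃ u v a c, G.Adj u v ∧ G.Adj u a ∧ ¬ G.Adj v a ∧
      a ≠ v ∧ G.Adj v c ∧ ¬ G.Adj u c ∧ c ≠ u := by
  classical
  obtain ⟨u, hu⟩ := Finite.exists_max (deg G)
  obtain ⟨z, hzu, hz⟩ := hdom u
  -- some vertex is at distance two from `u`
  obtain ⟨v, c, huv, hvc, hcu, huc⟩ : ∃ v c, G.Adj u v ∧ G.Adj v c ∧ c ≠ u ∧ ¬ G.Adj u c := by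
    by_contra! hcon
    have : ∀ y, Relation.ReflTransGen G.Adj u y → y = u ∨ G.Adj u y := fun y hy => by
      induction hy with
      | refl => exact Or.inl rfl
      | @tail b d _ hbd ih =>
        rcases ih with rfl | ih
        · exact Or.inr hbd
        · by_cases hd : d = u
          · exact Or.inl hd
          · exact Or.inr (hcon b d ih hbd hd)
    have := this z ((G.reachable_iff_reflTransGen u z).1 (hG.preconnected u z))
    tauto
  by_contra! hcon
  -- otherwise the degree of `v` would exceed that of `u`
  have hsub : insert c (insert u ((Finset.univ.filter (G.Adj u)).erase v)) ⊆
      Finset.univ.filter (G.Adj v) := by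
    intro y hy
    simp only [Finset.mem_insert, Finset.mem_erase, Finset.mem_filter, Finset.mem_univ,
      true_and] at hy ⊢
    rcases hy with rfl | rfl | ⟨hyv, hy⟩
    · exact hvc
    · exact huv.symm
    · by_contra h
      exact hcu (hcon u v y c huv hy h hyv hvc huc)
  have h1 := Finset.card_le_card hsub
  rw [Finset.card_insert_of_notMem, Finset.card_insert_of_notMem, Finset.card_erase_of_mem] at h1
  · have h2 := hu v
    have h3 := deg_pos_of_adj huv
    simp only [deg] at h2 h3
    omega
  · simpa using huv
  · simp
  · simp [hcu, huc]

end Classification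

/-! ### Rows of the matrix and double brooms -/

section Rows

variable {V : Type*} [Fintype V] {G : SimpleGraph V} {p : ℝ}

/-- A row of the matrix applied to a vector, if all neighbours of `i` outside `s` contribute the
same amount `τ`. -/
theorem sum_pSomborMatrix_mul {i : V} (x : V → ℝ) (s : Finset V) (hs : ∀ j ∈ s, G.Adj i j) (τ : ℝ)
    (h : ∀ j, G.Adj i j → j ∉ s → pSomborMatrix G p i j * x j = τ) :
    ∑ j, pSomborMatrix G p i j * x j =
      ∑ j ∈ s, pSomborMatrix G p i j * x j + ((deg G i : ℝ) - s.card) * τ := by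
  classical
  have hsub : s ⊆ Finset.univ.filter (G.Adj i) := fun j hj => by simpa using hs j hj
  have h1 : ∑ j, pSomborMatrix G p i j * x j =
      ∑ j ∈ Finset.univ.filter (G.Adj i), pSomborMatrix G p i j * x j := by
    refine (Finset.sum_subset (Finset.subset_univ _) fun j _ hj => ?_).symm
    rw [pSomborMatrix_of_not_adj (by simpa using hj), zero_mul]
  have h2 : ∑ j ∈ Finset.univ.filter (G.Adj i) \ s, pSomborMatrix G p i j * x j =
      ((deg G i : ℝ) - s.card) * τ := by
    have hcard : ((Finset.univ.filter (G.Adj i) \ s).card : ℝ) = (deg G i : ℝ) - s.card := by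
      rw [Finset.card_sdiff_of_subset hsub, Nat.cast_sub (Finset.card_le_card hsub), deg]
    rw [← hcard, ← nsmul_eq_mul]
    refine Finset.sum_eq_card_nsmul fun j hj => ?_
    rw [Finset.mem_sdiff] at hj
    exact h j (by simpa using hj.1) hj.2
  rw [h1, ← Finset.sum_sdiff hsub, h2, add_comm]

open Matrix in
/-- A trial vector that solves the eigenvalue equation for `r` outside `s` needs to be tested only
on `s`. -/
theorem lt_pSomborRadius_of_sum [Nonempty V] {r : ℝ} (x : V → ℝ) (s : Finset V)
    (h0 : ∀ i ∉ s, ∑ j, pSomborMatrix G p i j * x j = r * x i)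
    (h : 0 < ∑ i ∈ s, x i * (∑ j, pSomborMatrix G p i j * x j - r * x i)) :
    r < pSomborRadius G p := by
  refine lt_pSomborRadius x ?_
  have h1 : ∑ i, x i * (∑ j, pSomborMatrix G p i j * x j - r * x i) =
      ∑ i ∈ s, x i * (∑ j, pSomborMatrix G p i j * x j - r * x i) := by
    refine (Finset.sum_subset (Finset.subset_univ _) fun i _ hi => ?_).symm
    rw [h0 i hi, sub_self, mul_zero]
  rw [← h1] at h
  have h2 : x ⬝ᵥ pSomborMatrix G p *ᵥ x - r * (x ⬝ᵥ x) =
      ∑ i, x i * (∑ j, pSomborMatrix G p i j * x j - r * x i) := by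
    simp only [dotProduct, mulVec, Finset.mul_sum, mul_sub, Finset.sum_sub_distrib]
    congr 1
    exact Finset.sum_congr rfl fun i _ => by ring
  linarith

theorem deg_eq_one {i j : V} (h : ∀ k, G.Adj i k ↔ k = j) : deg G i = 1 := by
  rw [deg, Finset.card_eq_one]
  exact ⟨j, by ext k; simp [h]⟩

theorem sum_pSomborMatrix_mul_pendant {i j : V} (x : V → ℝ) (h : ∀ k, G.Adj i k ↔ k = j) :
    ∑ k, pSomborMatrix G p i k * x k = wt p (deg G j) 1 * x j := by
  rw [sum_pSomborMatrix_mul x {j} (by simp [h]) 0 fun k hk hkj => (hkj (by simp [(h k).1 hk])).elim,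
    Finset.sum_singleton, pSomborMatrix_of_adj ((h j).2 rfl), deg_eq_one h, mul_zero, add_zero,
    Nat.cast_one, wt_comm]

end Rows

section DoubleBroom

variable {V : Type*} {G : SimpleGraph V} {p : ℝ} {u v d e : V}

theorem IsDoubleBroom.symm (h : IsDoubleBroom G u v d e) : IsDoubleBroom G v u d e where
  adj := h.adj.symm
  ne := h.ne
  adj_d k := (h.adj_d k).trans or_comm
  adj_e k := (h.adj_e k).trans or_comm
  pendant j h1 h2 h3 h4 := (h.pendant j h2 h1 h3 h4).symm

theorem IsDoubleBroom.adj_ud (h : IsDoubleBroom G u v d e) : G.Adj u d :=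
  ((h.adj_d u).2 (Or.inl rfl)).symm

theorem IsDoubleBroom.adj_ue (h : IsDoubleBroom G u v d e) : G.Adj u e :=
  ((h.adj_e u).2 (Or.inl rfl)).symm

theorem IsDoubleBroom.adj_pendant (h : IsDoubleBroom G u v d e) {j : V} (huj : G.Adj u j)
    (hjv : j ≠ v) (hjd : j ≠ d) (hje : j ≠ e) (k : V) : G.Adj j k ↔ k = u := by
  rcases h.pendant j huj.ne' hjv hjd hje with h1 | h1
  · exact h1 k
  · exact (h.adj.ne ((h1 u).1 huj.symm)).elim

variable [Fintype V]

theorem IsDoubleBroom.deg_d (h : IsDoubleBroom G u v d e) : deg G d = 2 := by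
  classical
  rw [deg, Finset.card_eq_two]
  exact ⟨u, v, h.adj.ne, by ext k; simp [h.adj_d]⟩

theorem IsDoubleBroom.deg_e (h : IsDoubleBroom G u v d e) : deg G e = 2 := by
  classical
  rw [deg, Finset.card_eq_two]
  exact ⟨u, v, h.adj.ne, by ext k; simp [h.adj_e]⟩

/-- The eigenvalue equation at the hub `u`, with the weights of its pendent vertices eliminated. -/
theorem IsDoubleBroom.sum_row (h : IsDoubleBroom G u v d e) {x : V → ℝ} {r : ℝ} (hr : 0 < r)
    (hS : ∀ i, ∑ j, pSomborMatrix G p i j * x j = r * x i) :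
    r * x u = wt p (deg G u) (deg G v) * x v + wt p (deg G u) 2 * (x d + x e) +
      ((deg G u : ℝ) - 3) * (wt p (deg G u) 1 ^ 2 / r) * x u := by
  classical
  have hvd : v ≠ d := fun e => by simpa [e] using h.symm.adj_ud
  have hve : v ≠ e := fun e => by simpa [e] using h.symm.adj_ue
  rw [← hS u, sum_pSomborMatrix_mul x {v, d, e} (by simp [h.adj, h.adj_ud, h.adj_ue])
    (wt p (deg G u) 1 ^ 2 / r * x u) fun j hj hjs => ?_]
  · rw [Finset.sum_insert (by simp [hvd, hve]), Finset.sum_insert (by simp [h.ne]),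
      Finset.sum_singleton, Finset.card_insert_of_notMem (by simp [hvd, hve]),
      Finset.card_insert_of_notMem (by simp [h.ne]), Finset.card_singleton,
      pSomborMatrix_of_adj h.adj, pSomborMatrix_of_adj h.adj_ud, pSomborMatrix_of_adj h.adj_ue,
      h.deg_d, h.deg_e]
    push_cast
    ring
  · simp only [Finset.mem_insert, Finset.mem_singleton, not_or] at hjs
    have hk := h.adj_pendant hj hjs.1 hjs.2.1 hjs.2.2
    have h1 := hS j
    rw [sum_pSomborMatrix_mul_pendant x hk] at h1
    rw [pSomborMatrix_of_adj hj, deg_eq_one hk, Nat.cast_one, eq_div_of_mul_eq hr.ne'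
      ((mul_comm _ _).trans h1.symm)]
    ring

theorem IsDoubleBroom.three_le_deg (h : IsDoubleBroom G u v d e) : 3 ≤ deg G u := by
  classical
  have hvd : v ≠ d := fun e => by simpa [e] using h.symm.adj_ud
  have hve : v ≠ e := fun e => by simpa [e] using h.symm.adj_ue
  have : ({v, d, e} : Finset V) ⊆ Finset.univ.filter (G.Adj u) := by
    intro j hj
    simp only [Finset.mem_insert, Finset.mem_singleton] at hj
    rcases hj with rfl | rfl | rfl <;> simp [h.adj, h.adj_ud, h.adj_ue]
  have := Finset.card_le_card this
  rwa [Finset.card_insert_of_notMem (by simp [hvd, hve]),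
    Finset.card_insert_of_notMem (by simp [h.ne]), Finset.card_singleton] at this

/-- In a double broom, the hub of larger degree has the larger Perron weight. -/
theorem IsDoubleBroom.perron_le (hp : 1 ≤ p) (h : IsDoubleBroom G u v d e) {x : V → ℝ} {r : ℝ}
    (hr : 0 < r) (hx : ∀ i, 0 < x i)
    (hS : ∀ i, ∑ j, pSomborMatrix G p i j * x j = r * x i) (hd : deg G v ≤ deg G u) :
    x v ≤ x u := by
  by_contra! hlt
  have hp0 : 0 < p := by linarith
  have h1 := h.sum_row hr hS
  have h2 := h.symm.sum_row hr hS
  have hdR : (deg G v : ℝ) ≤ deg G u := by exact_mod_cast hd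
  have h3 : (3 : ℝ) ≤ deg G v := by exact_mod_cast h.symm.three_le_deg
  rw [wt_comm p (deg G v) (deg G u)] at h2
  have hW : 0 ≤ wt p (deg G u) (deg G v) := wt_nonneg (Nat.cast_nonneg _) (Nat.cast_nonneg _)
  have hw2 : wt p (deg G v) 2 ≤ wt p (deg G u) 2 :=
    wt_le_wt hp0 (Nat.cast_nonneg _) (by norm_num) hdR le_rfl
  have hw1 : wt p (deg G v) 1 ≤ wt p (deg G u) 1 :=
    wt_le_wt hp0 (Nat.cast_nonneg _) (by norm_num) hdR le_rfl
  have hw0 : 0 ≤ wt p (deg G v) 1 := wt_nonneg (Nat.cast_nonneg _) (by norm_num)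
  have hw20 : 0 ≤ wt p (deg G v) 2 := wt_nonneg (Nat.cast_nonneg _) (by norm_num)
  have hab : ((deg G v : ℝ) - 3) * (wt p (deg G v) 1 ^ 2 / r) ≤
      ((deg G u : ℝ) - 3) * (wt p (deg G u) 1 ^ 2 / r) :=
    mul_le_mul (by linarith) (div_le_div_of_nonneg_right (pow_le_pow_left₀ hw0 hw1 2) hr.le)
      (by positivity) (by linarith)
  set α := ((deg G u : ℝ) - 3) * (wt p (deg G u) 1 ^ 2 / r)
  set β := ((deg G v : ℝ) - 3) * (wt p (deg G v) 1 ^ 2 / r)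
  set W := wt p (deg G u) (deg G v)
  have hde : 0 < x d + x e := add_pos (hx d) (hx e)
  have hβ : 0 ≤ r - β := by
    have h4 : 0 ≤ (r - β) * x v := by
      have := mul_nonneg hW (hx u).le
      have := mul_nonneg hw20 hde.le
      linarith
    exact nonneg_of_mul_nonneg_left h4 (hx v)
  have h5 := mul_le_mul_of_nonneg_right hw2 hde.le
  have h6 := mul_le_mul_of_nonneg_right hab (hx u).le
  have h7 : 0 < (r - β + W) * (x v - x u) ∨ r - β + W = 0 := by
    rcases (add_nonneg hβ hW).eq_or_lt with h8 | h8
    · exact Or.inr h8.symm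
    · exact Or.inl (mul_pos h8 (by linarith))
  rcases h7 with h7 | h7
  · linarith
  · have : 0 < r - β + W :=
      add_pos_of_nonneg_of_pos hβ (wt_pos_left (by linarith) (Nat.cast_nonneg _))
    linarith

open Classical in
/-- Every double broom with pendent vertices at both hubs is `B₃` or has a smaller spectral
radius: moving all but one of the pendent vertices of the smaller hub to the other hub increases
the spectral radius. -/
theorem IsDoubleBroom.lt_or_iso {n : ℕ} (hn : 6 ≤ n) (hV : Fintype.card V = n) (hp : 1 ≤ p)
    (hG : IsBicyclic G) (h : IsDoubleBroom G u v d e) {a c : V}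
    (hua : G.Adj u a) (hva : ¬ G.Adj v a) (hav : a ≠ v)
    (hvc : G.Adj v c) (huc : ¬ G.Adj u c) (hcu : c ≠ u) :
    pSomborRadius G p < pSomborRadius (graphB3 n) p ∨ Nonempty (G ≃g graphB3 n) := by
  wlog hd : deg G v ≤ deg G u generalizing u v a c
  · exact this h.symm hvc huc hcu hua hva hav (by omega)
  have hp0 : 0 < p := by linarith
  have hB := isBicyclic_graphB3 hn
  have := hG.1.nonempty
  have : Nontrivial V := Fintype.one_lt_card_iff_nontrivial.1 (by omega)
  have hdu : d ≠ u := h.adj_ud.ne'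
  have heu : e ≠ u := h.adj_ue.ne'
  have hdc : d ≠ c := fun e => huc (e ▸ h.adj_ud)
  have hec : e ≠ c := fun e => huc (e ▸ h.adj_ue)
  have hde := h.ne
  have hcov : ∀ j, j ≠ u → G.Adj u j ∨ (G.Adj v j ∧ ¬ G.Adj u j) := fun j hj => by
    by_cases huj : G.Adj u j
    · exact Or.inl huj
    refine Or.inr ⟨?_, huj⟩
    by_cases hjv : j = v
    · exact (huj (hjv ▸ h.adj)).elim
    by_cases hjd : j = d
    · exact (huj (hjd ▸ h.adj_ud)).elim
    by_cases hje : j = e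
    · exact (huj (hje ▸ h.adj_ue)).elim
    rcases h.pendant j hj hjv hjd hje with h1 | h1
    · exact (huj ((h1 u).2 rfl).symm).elim
    · exact ((h1 v).2 rfl).symm
  set M := Finset.univ.filter fun j => G.Adj v j ∧ ¬ G.Adj u j ∧ j ≠ u ∧ j ≠ c with hM
  have hsh : Shiftable G u v M := ⟨h.adj.ne, fun m hm => by
    have : G.Adj v m ∧ ¬ G.Adj u m ∧ m ≠ u ∧ m ≠ c := by simpa [hM] using hm
    exact ⟨this.1, this.2.1, this.2.2.1⟩⟩
  have hcM : c ∉ M := by simp [hM]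
  have hiso : Nonempty (shift G u v M ≃g graphB3 n) := by
    refine nonempty_iso_graphB3 hV (isBicyclic_shift hG hsh (Or.inl h.adj)) hB (u := u) (v := v)
      (a := d) (b := e) (c := c) (fun j hj hjc => ?_) h.adj.ne' hdu heu hcu hde hdc hec
      ((shift_adj_right hsh).2 ⟨h.symm.adj_ud, by simp [hM, h.adj_ud]⟩)
      ((shift_adj_right hsh).2 ⟨h.symm.adj_ue, by simp [hM, h.adj_ue]⟩)
      ((shift_adj_right hsh).2 ⟨hvc, hcM⟩)
    refine (shift_adj_left hsh).2 ((hcov j hj).imp_right fun h1 => ?_)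
    simp [hM, h1, hj, hjc]
  rcases M.eq_empty_or_nonempty with hM0 | ⟨m, hm⟩
  · refine Or.inr (nonempty_iso_graphB3 hV hG hB (u := u) (v := v) (a := d) (b := e) (c := c)
      (fun j hj hjc => ?_) h.adj.ne' hdu heu hcu hde hdc hec h.symm.adj_ud h.symm.adj_ue hvc)
    refine (hcov j hj).resolve_right fun h1 => ?_
    have : j ∈ M := by simp [hM, h1, hj, hjc]
    simp [hM0] at this
  left
  obtain ⟨φ⟩ := hiso
  rw [← pSomborRadius_iso φ]
  obtain ⟨x, hx, hS⟩ := exists_perron_vector (p := p) hG.1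
  have hr := pSomborRadius_pos (p := p) hG.1
  have hxx := h.perron_le hp hr hx hS hd
  have hdM : deg G v ≤ deg G u + M.card := by omega
  refine pSomborRadius_lt_shift hp hsh hx hS hdM ?_
  have hac : a ≠ c := fun e => huc (e ▸ hua)
  have ha : a ∈ (Finset.univ.erase u).erase v := by simp [hav, hua.ne']
  have hc : c ∈ ((Finset.univ.erase u).erase v).erase a := by simp [hvc.ne', hcu, hac.symm]
  rw [← Finset.add_sum_erase _ _ ha, ← Finset.add_sum_erase _ _ hc, ← add_assoc]
  refine add_pos_of_nonneg_of_pos ?_ (Finset.sum_pos' (fun j hj => ?_) ⟨m, ?_, ?_⟩)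
  · -- the gain at the pendent vertex `a` of `u` outweighs the loss at the pendent vertex `c` of `v`
    have hka := h.adj_pendant hua hav (fun e => hva (e ▸ h.symm.adj_ud))
      (fun e => hva (e ▸ h.symm.adj_ue))
    have hkc := h.symm.adj_pendant hvc hcu hdc.symm hec.symm
    have ea := hS a
    have ec := hS c
    rw [sum_pSomborMatrix_mul_pendant x hka] at ea
    rw [sum_pSomborMatrix_mul_pendant x hkc] at ec
    rw [shiftGain_of_adj_left hsh hua hva hav, shiftGain_of_adj_right hsh huc hvc hcu hcM,
      deg_eq_one hka, deg_eq_one hkc, Nat.cast_one]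
    have hdR : (deg G v : ℝ) ≤ deg G u := by exact_mod_cast hd
    have e2 : (deg G v : ℝ) = deg (shift G u v M) v + M.card := by
      exact_mod_cast (deg_shift_right hsh).symm
    have hw1 : wt p (deg G v) 1 ≤ wt p (deg G u) 1 :=
      wt_le_wt hp0 (Nat.cast_nonneg _) zero_le_one hdR le_rfl
    have hw0 : 0 ≤ wt p (deg G v) 1 := wt_nonneg (Nat.cast_nonneg _) zero_le_one
    have hxac : x c ≤ x a := by
      have := mul_le_mul hw1 hxx (hx v).le (hw0.trans hw1)
      rw [ea, ec] at this
      exact le_of_mul_le_mul_left this hr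
    have hinc := wt_increment_le (b := 1) (x := deg (shift G u v M) v) (y := deg G u)
      (k := M.card) hp zero_le_one (Nat.cast_nonneg _)
      (by have : (0 : ℝ) ≤ M.card := Nat.cast_nonneg _
          linarith) (Nat.cast_nonneg _)
    have hmono : wt p (deg (shift G u v M) v) 1 ≤ wt p (deg (shift G u v M) v + M.card) 1 :=
      wt_le_wt hp0 (Nat.cast_nonneg _) zero_le_one (le_add_of_nonneg_right (Nat.cast_nonneg _))
        le_rfl
    rw [e2]
    have h1 : x v * x c ≤ x u * x a := mul_le_mul hxx hxac (hx c).le (hx u).le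
    have h2 := mul_le_mul hinc h1 (mul_nonneg (hx v).le (hx c).le)
      ((sub_nonneg.2 hmono).trans hinc)
    linarith
  · refine mul_nonneg ?_ (hx j).le
    simp only [Finset.mem_erase, Finset.mem_univ, and_true] at hj
    by_cases h1 : G.Adj u j <;> by_cases h2 : G.Adj v j
    · exact shiftGain_of_adj_adj hp hsh hx hxx hdM h1 h2
    · exact (shiftGain_of_adj_left_pos hp0 hsh hx ⟨m, hm⟩ h1 h2 hj.2.2.1).le
    · exact (shiftGain_of_mem hp hsh hx hxx hdM (by simp [hM, h1, h2, hj])).1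
    · exact (shiftGain_of_not_adj hsh h1 h2).ge
  · have h1 := hsh.2 m hm
    have h2 : m ≠ a := fun e => h1.2.1 (e ▸ hua)
    have h3 : m ≠ c := fun e => hcM (e ▸ hm)
    simp [h2, h3, h1.2.2, h1.1.ne']
  · have := Finset.card_pos.2 ⟨m, hm⟩
    exact mul_pos ((shiftGain_of_mem hp hsh hx hxx hdM hm).2 (by omega)) (hx m)

end DoubleBroom

/-! ### Numerical inequalities -/

section Inequalities

/-- Eliminating the weights `z` and `y` from the eigenvalue equations of a kite bounds the
eigenvalue `r` from below; the letters are those of `kite_inequality`. -/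
theorem kite_radius_lower {N r z y F g h τ : ℝ} (hN : 4 ≤ N) (hr : 0 < r) (hz : 0 < z) (hy : 0 < y)
    (hF : 0 < F) (hh : 0 < h)
    (h1 : r ^ 2 * z = 2 * F * r * y + (N - 2) * τ ^ 2 * z)
    (h2 : r ^ 2 * y = F * r * z + g * r * y + 2 * h ^ 2 * y)
    (hhg : h ≤ g) (hFh : 16 / 9 * h ^ 2 ≤ F ^ 2) (hτh : 17 / 13 * h ^ 2 ≤ τ ^ 2) :
    3.1 * h ≤ r := by
  by_contra! hlt
  have e1 : F * r * z ≤ (r - 2 * h) * (r + h) * y := by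
    have : h * r * y ≤ g * r * y := by gcongr
    nlinarith
  have e2 : 0 < (r - 2 * h) * (r + h) := by
    have : 0 < (r - 2 * h) * (r + h) * y := lt_of_lt_of_le (by positivity) e1
    exact pos_of_mul_pos_left this hy.le
  have e3 : (r - 2 * h) * (r + h) ≤ 4.51 * h ^ 2 := by nlinarith
  have e4 : 2 * F * r * y ≤ (r ^ 2 - 34 / 13 * h ^ 2) * z := by
    have : 2 * (17 / 13 * h ^ 2) ≤ (N - 2) * τ ^ 2 := by
      refine mul_le_mul (by linarith) hτh (by positivity) (by linarith)
    nlinarith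
  have e5 : 0 < r ^ 2 - 34 / 13 * h ^ 2 := by
    have : 0 < (r ^ 2 - 34 / 13 * h ^ 2) * z := lt_of_lt_of_le (by positivity) e4
    exact pos_of_mul_pos_left this hz.le
  have e6 : (2 * F * r * y) * (F * r * z) ≤
      ((r ^ 2 - 34 / 13 * h ^ 2) * z) * (4.51 * h ^ 2 * y) :=
    mul_le_mul e4 (e1.trans (mul_le_mul_of_nonneg_right e3 hy.le)) (by positivity) (by positivity)
  have e7 : 2 * F ^ 2 * r ^ 2 ≤ (r ^ 2 - 34 / 13 * h ^ 2) * (4.51 * h ^ 2) := by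
    refine le_of_mul_le_mul_right (a := y * z) ?_ (by positivity)
    linarith
  have e8 : 2 * (16 / 9 * h ^ 2) * r ^ 2 ≤ (r ^ 2 - 34 / 13 * h ^ 2) * (4.51 * h ^ 2) := by
    refine le_trans ?_ e7
    gcongr
  have e9 : r ^ 2 < 9.61 * h ^ 2 := by nlinarith
  have h4 : 0 < h ^ 2 := by positivity
  nlinarith

/-- The gain of the trial vector that compares a kite with `B₃` is positive. The letters stand for
the weights of edges with the following degrees at their ends: `F` for `N, 3`; `g` for `3, 3`; `h`
for `3, 2`; `τ` for `N, 1`; `b` for `4, 2`; `c` for `4, 1`. The hypotheses on their squares are the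
ratios at `p = 2`. -/
theorem kite_inequality {N r z y F g h τ b c : ℝ} (hN : 4 ≤ N) (hr : 0 < r) (hz : 0 < z)
    (hy : 0 < y) (hF : 0 < F) (hg : 0 < g) (hh : 0 < h) (hτ : 0 < τ) (hb : 0 < b)
    (h1 : r ^ 2 * z = 2 * F * r * y + (N - 2) * τ ^ 2 * z)
    (h2 : r ^ 2 * y = F * r * z + g * r * y + 2 * h ^ 2 * y)
    (hFτ : F ^ 2 ≤ 25 / 17 * τ ^ 2) (hbh : 20 / 13 * h ^ 2 ≤ b ^ 2) (hgh : g ^ 2 ≤ 18 / 13 * h ^ 2)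
    (hhg : h ≤ g) (hch : 17 / 13 * h ^ 2 ≤ c ^ 2) (hFh : 16 / 9 * h ^ 2 ≤ F ^ 2)
    (hτh : 17 / 13 * h ^ 2 ≤ τ ^ 2) :
    0 < b * τ * z + r * (b - g) * y + (c ^ 2 / 2 - 2 * h ^ 2) * y := by
  have hr3 := kite_radius_lower hN hr hz hy hF hh h1 h2 hhg hFh hτh
  -- the decimals are `√(17 / 25)`, `√(20 / 13)`, `√(18 / 13)`, rounded in the safe direction
  have hFτ' : 0.8246 * F ≤ τ := by
    refine le_of_sq_le_sq ?_ hτ.le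
    nlinarith
  have hb' : 1.2403 * h ≤ b := by
    refine le_of_sq_le_sq ?_ hb.le
    nlinarith
  have hg' : g ≤ 1.1768 * h := by
    refine le_of_sq_le_sq ?_ (by positivity)
    nlinarith
  obtain ⟨D, hD⟩ : ∃ D, D = r ^ 2 - 1.1768 * h * r - 2 * h ^ 2 := ⟨_, rfl⟩
  have hD0 : 0 < D := by
    have := mul_le_mul_of_nonneg_right hr3 hr.le
    have := mul_le_mul_of_nonneg_left hr3 hh.le
    nlinarith
  have hDF : D * y ≤ F * r * z := by
    have := mul_le_mul_of_nonneg_right hg' (show 0 ≤ r * y by positivity)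
    rw [hD]
    linarith
  have e1 : 0.8246 * b * (D * y) ≤ b * τ * (r * z) := by
    have := mul_le_mul_of_nonneg_left hDF (show 0 ≤ 0.8246 * b by positivity)
    have := mul_le_mul_of_nonneg_right hFτ' (show 0 ≤ b * (r * z) by positivity)
    linarith
  have e2 : 1.2403 * h * (0.8246 * D + r ^ 2) * y ≤ b * (0.8246 * D + r ^ 2) * y := by
    have := mul_le_mul_of_nonneg_right hb' (show 0 ≤ (0.8246 * D + r ^ 2) * y by positivity)
    linarith
  have e3 : g * r ^ 2 * y ≤ 1.1768 * h * r ^ 2 * y := by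
    have := mul_le_mul_of_nonneg_right hg' (show 0 ≤ r ^ 2 * y by positivity)
    linarith
  have e4 : -(35 / 26 * h ^ 2) * (r * y) ≤ (c ^ 2 / 2 - 2 * h ^ 2) * (r * y) :=
    mul_le_mul_of_nonneg_right (by linarith) (by positivity)
  have e5 : 0 < 1.2403 * (0.8246 * D + r ^ 2) - 1.1768 * r ^ 2 - 35 / 26 * h * r := by
    rw [hD]
    nlinarith
  have e6 : 0 < (1.2403 * (0.8246 * D + r ^ 2) - 1.1768 * r ^ 2 - 35 / 26 * h * r) * (h * y) :=
    mul_pos e5 (mul_pos hh hy)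
  refine pos_of_mul_pos_left (a := b * τ * z + r * (b - g) * y + (c ^ 2 / 2 - 2 * h ^ 2) * y)
    (b := r) ?_ hr.le
  linarith

/-- Eliminating the Perron weights `z`, `y` of the two hubs of `B₃` from their equations: a linear
system of two equations with a positive solution has determinant zero. -/
theorem eliminate_hubs {N r z y E B τ b c : ℝ} (hz : 0 < z) (hy : 0 < y) (hr : 0 < r) (hE : 0 < E)
    (hB : 0 < B) (hb : 0 < b)
    (h1 : r ^ 2 * z = E * r * y + 2 * B * (B * z + b * y) + (N - 3) * τ ^ 2 * z)
    (h2 : r ^ 2 * y = E * r * z + 2 * b * (B * z + b * y) + c ^ 2 * y) :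
    (r ^ 2 - (N - 3) * τ ^ 2 - 2 * B ^ 2) * (r ^ 2 - c ^ 2 - 2 * b ^ 2) =
      (E * r + 2 * B * b) ^ 2 ∧ 0 < r ^ 2 - c ^ 2 - 2 * b ^ 2 := by
  have e1 : (r ^ 2 - (N - 3) * τ ^ 2 - 2 * B ^ 2) * z = (E * r + 2 * B * b) * y := by linarith
  have e2 : (r ^ 2 - c ^ 2 - 2 * b ^ 2) * y = (E * r + 2 * B * b) * z := by linarith
  have hS : 0 < E * r + 2 * B * b := by positivity
  constructor
  · refine mul_right_cancel₀ (b := z * y) (by positivity) ?_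
    linear_combination (r ^ 2 - c ^ 2 - 2 * b ^ 2) * y * e1 + (E * r + 2 * B * b) * y * e2
  · have : 0 < (r ^ 2 - c ^ 2 - 2 * b ^ 2) * y := by rw [e2]; positivity
    exact pos_of_mul_pos_left this hy.le

/-- Neglecting the two edges of `B₂` that avoid the centre, of weight `g`, in the inequality that
the trial vector on `B₂` leads to. -/
theorem le_sq_of_cubic_le {r g X Y : ℝ} (hg : 0 < g) (hgr : g < r) (hX : 0 ≤ X)
    (h : X * r + Y * (r - g) ≤ r ^ 2 * (r - g)) : X + Y ≤ r ^ 2 := by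
  refine le_of_mul_le_mul_right (a := r - g) ?_ (by linarith)
  nlinarith

/-- The comparison of `B₃` with `B₂` for order `N + 2 ≥ 8`. In this and the next two lemmas the
letters stand for the weights of edges with the following degrees at their ends: `E` for `N, 4`; `B`
for `N, 2`; `τ` for `N, 1`; `b` for `4, 2`; `c` for `4, 1`; `B'` for `N + 1, 2`; `τ'` for
`N + 1, 1`. -/
theorem radius_inequality_large {N r E B τ b c B' τ' : ℝ} (hN : 6 ≤ N) (hr : 0 < r)
    (hE : 0 < E) (hB : 0 < B) (hb : 0 < b)
    (h : (r ^ 2 - (N - 3) * τ ^ 2 - 2 * B ^ 2) * (r ^ 2 - c ^ 2 - 2 * b ^ 2) =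
      (E * r + 2 * B * b) ^ 2) (hr2 : 4 * B' ^ 2 + (N - 3) * τ' ^ 2 ≤ r ^ 2)
    (hEN : E ^ 2 ≤ N ^ 2 + 16) (hBN : B ^ 2 ≤ N ^ 2 + 4) (hτN : τ ^ 2 ≤ N ^ 2 + 1)
    (hb2 : b ^ 2 ≤ 20) (hc2 : c ^ 2 ≤ 17) (hB' : (N + 1) ^ 2 ≤ B' ^ 2)
    (hτ' : (N + 1) ^ 2 ≤ τ' ^ 2) : False := by
  have e1 : (N + 1) ^ 3 ≤ r ^ 2 := by
    have : (N - 3) * (N + 1) ^ 2 ≤ (N - 3) * τ' ^ 2 :=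
      mul_le_mul_of_nonneg_left hτ' (by linarith)
    linarith
  have e2 : 343 ≤ r ^ 2 := by
    have : (7 : ℝ) ^ 3 ≤ (N + 1) ^ 3 := pow_le_pow_left₀ (by norm_num) (by linarith) 3
    linarith
  have e3 : 18.5 ≤ r := le_of_sq_le_sq (by linarith) hr.le
  have e4 : 4 * N ^ 2 ≤ r ^ 2 - (N - 3) * τ ^ 2 - 2 * B ^ 2 := by
    have : (N - 3) * τ ^ 2 ≤ (N - 3) * (N ^ 2 + 1) := mul_le_mul_of_nonneg_left hτN (by linarith)
    nlinarith
  -- the decimals are `√(52 / 36)`, `√(40 / 36)`, `√20`, rounded up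
  have e5 : E ≤ 1.202 * N := le_of_sq_le_sq (by nlinarith) (by linarith)
  have e6 : B ≤ 1.0542 * N := le_of_sq_le_sq (by nlinarith) (by linarith)
  have e7 : b ≤ 4.473 := le_of_sq_le_sq (by linarith) (by norm_num)
  have e8 : B * b ≤ 1.0542 * N * 4.473 := mul_le_mul e6 e7 hb.le (by linarith)
  have e9 : E * r + 2 * B * b ≤ 1.712 * N * r := by
    have : E * r ≤ 1.202 * N * r := by gcongr
    have : 0 ≤ N * (r - 18.5) := mul_nonneg (by linarith) (by linarith)
    nlinarith
  have e10 : (E * r + 2 * B * b) ^ 2 ≤ (1.712 * N * r) ^ 2 :=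
    pow_le_pow_left₀ (by positivity) e9 2
  have e11 : 0.83 * r ^ 2 ≤ r ^ 2 - c ^ 2 - 2 * b ^ 2 := by linarith
  have e12 : 4 * N ^ 2 * (0.83 * r ^ 2) ≤
      (r ^ 2 - (N - 3) * τ ^ 2 - 2 * B ^ 2) * (r ^ 2 - c ^ 2 - 2 * b ^ 2) :=
    mul_le_mul e4 e11 (by positivity) (le_trans (by positivity) e4)
  have e13 : 0 < N ^ 2 * r ^ 2 := by positivity
  rw [h] at e12
  nlinarith

/-- The comparison of `B₃` with `B₂` for order `7`, that is `N = 5`. -/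
theorem radius_inequality_seven {r E B τ b c B' τ' : ℝ} (hr : 0 < r)
    (hE : 0 < E) (hB : 0 < B) (hb : 0 < b)
    (h : (r ^ 2 - 2 * τ ^ 2 - 2 * B ^ 2) * (r ^ 2 - c ^ 2 - 2 * b ^ 2) =
      (E * r + 2 * B * b) ^ 2) (hr2 : 4 * B' ^ 2 + 2 * τ' ^ 2 ≤ r ^ 2)
    (hEB : E ^ 2 ≤ 41 / 29 * B ^ 2) (hbB : b ^ 2 ≤ 20 / 29 * B ^ 2) (hcb : c ^ 2 ≤ b ^ 2)
    (hτB : 26 / 29 * B ^ 2 ≤ τ ^ 2) (hB' : 40 / 29 * B ^ 2 ≤ B' ^ 2)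
    (hτ' : 37 / 26 * τ ^ 2 ≤ τ' ^ 2) : False := by
  have hB2 : 0 < B ^ 2 := by positivity
  have e1 : 234 / 29 * B ^ 2 ≤ r ^ 2 := by linarith
  have e2 : 2.84 * B ≤ r := le_of_sq_le_sq (by nlinarith) hr.le
  have e3 : 124 / 29 * B ^ 2 ≤ r ^ 2 - 2 * τ ^ 2 - 2 * B ^ 2 := by linarith
  have e4 : r ^ 2 - 60 / 29 * B ^ 2 ≤ r ^ 2 - c ^ 2 - 2 * b ^ 2 := by linarith
  -- the decimals are `√(41 / 29)` and `√(20 / 29)`, rounded up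
  have e5 : E ≤ 1.1891 * B := le_of_sq_le_sq (by nlinarith) (by linarith)
  have e6 : b ≤ 0.8305 * B := le_of_sq_le_sq (by nlinarith) (by linarith)
  have e7 : E * r + 2 * B * b ≤ 1.1891 * B * r + 1.661 * B ^ 2 := by
    have : E * r ≤ 1.1891 * B * r := by gcongr
    have : B * b ≤ B * (0.8305 * B) := by gcongr
    nlinarith
  have e8 : (E * r + 2 * B * b) ^ 2 ≤ (1.1891 * B * r + 1.661 * B ^ 2) ^ 2 :=
    pow_le_pow_left₀ (by positivity) e7 2
  have e9 : 124 / 29 * B ^ 2 * (r ^ 2 - 60 / 29 * B ^ 2) ≤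
      (r ^ 2 - 2 * τ ^ 2 - 2 * B ^ 2) * (r ^ 2 - c ^ 2 - 2 * b ^ 2) :=
    mul_le_mul e3 e4 (by linarith) (le_trans (by positivity) e3)
  rw [h] at e9
  have e10 : (1.1891 * r + 1.661 * B) ^ 2 < 124 / 29 * (r ^ 2 - 60 / 29 * B ^ 2) := by
    nlinarith
  have e11 := mul_lt_mul_of_pos_left e10 hB2
  linarith

/-- The comparison of `B₃` with `B₂` for order `6`, that is `N = 4`, where the two hubs of `B₃` are
equivalent. Here `a` is the weight for degrees `4, 4`, and `a / 2` that for degrees `2, 2`; the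
edges of `B₂` that avoid the centre cannot be neglected. -/
theorem radius_inequality_six {r a b c B' τ' : ℝ} (hr : 0 < r) (ha : 0 < a) (hb : 0 < b)
    (h : (r ^ 2 - c ^ 2 - 2 * b ^ 2) ^ 2 = (a * r + 2 * b ^ 2) ^ 2)
    (hpos : 0 < r ^ 2 - c ^ 2 - 2 * b ^ 2)
    (hr3 : 4 * B' ^ 2 * r + τ' ^ 2 * (r - a / 2) ≤ r ^ 2 * (r - a / 2))
    (hab : a ^ 2 ≤ 8 / 5 * b ^ 2) (hc : 16 ≤ c ^ 2) (hc' : c ^ 2 ≤ 17) (hb2 : 16 ≤ b ^ 2)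
    (hb2' : b ^ 2 ≤ 20) (hB' : 29 / 20 * b ^ 2 ≤ B' ^ 2) (hτ' : 26 / 17 * c ^ 2 ≤ τ' ^ 2)
    (hτ'' : τ' ^ 2 ≤ 26) : False := by
  have hS : 0 < a * r + 2 * b ^ 2 := by positivity
  have e1 : r ^ 2 = a * r + 4 * b ^ 2 + c ^ 2 := by
    have := (sq_eq_sq₀ hpos.le hS.le).1 h
    linarith
  have e2 : 2.3 * a ≤ r := by
    by_contra! hlt
    have e3 : r * (r - a) ≤ 2.3 * a * (1.3 * a) :=
      mul_le_mul hlt.le (by linarith) (by nlinarith) (by positivity)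
    nlinarith
  have e3 : r ^ 2 * (r - a / 2) =
      (a ^ 2 / 2 + 4 * b ^ 2 + c ^ 2) * r + (4 * b ^ 2 + c ^ 2) * (a / 2) := by
    linear_combination (r + a / 2) * e1
  have e4 : (b ^ 2 + 144 / 17) * r ≤ (4 * B' ^ 2 + τ' ^ 2 - a ^ 2 / 2 - 4 * b ^ 2 - c ^ 2) * r := by
    gcongr
    linarith
  have e5 : (b ^ 2 + 144 / 17) * (2.3 * a) ≤ (b ^ 2 + 144 / 17) * r := by gcongr
  have e6 : (4 * b ^ 2 + c ^ 2 + τ' ^ 2) * (a / 2) ≤ (4 * b ^ 2 + 43) * (a / 2) :=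
    mul_le_mul_of_nonneg_right (by linarith) (by positivity)
  nlinarith

end Inequalities

/-! ### The rows of the matrices of `B₂` and `B₃` -/

section ExtremalRows

variable {N : ℕ} {p : ℝ}

theorem pSomborMatrix_graphB3 (hN : 4 ≤ N) {i j : Fin (N + 2)} (h : (graphB3 (N + 2)).Adj i j) :
    pSomborMatrix (graphB3 (N + 2)) p i j = wt p (degB3 (N + 2) i) (degB3 (N + 2) j) := by
  rw [pSomborMatrix_of_adj h, deg_graphB3 (by omega), deg_graphB3 (by omega)]

theorem pSomborMatrix_graphB2 (hN : 4 ≤ N) {i j : Fin (N + 2)} (h : (graphB2 (N + 2)).Adj i j) :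
    pSomborMatrix (graphB2 (N + 2)) p i j = wt p (degB2 (N + 2) i) (degB2 (N + 2) j) := by
  rw [pSomborMatrix_of_adj h, deg_graphB2 (by omega), deg_graphB2 (by omega)]

/-- The five distinguished vertices of `B₂` and `B₃`. -/
def vtx (hN : 4 ≤ N) (k : Fin 5) : Fin (N + 2) := ⟨k, by omega⟩

theorem val_vtx (hN : 4 ≤ N) : (vtx hN 0).val = 0 ∧ (vtx hN 1).val = 1 ∧ (vtx hN 2).val = 2 ∧
    (vtx hN 3).val = 3 ∧ (vtx hN 4).val = 4 := ⟨rfl, rfl, rfl, rfl, rfl⟩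

/-- The action of the matrix of `B₃` on a vector whose entries at the pendent vertices of the hub
`0` agree. -/
theorem graphB3_row_zero (hN : 4 ≤ N) (x : Fin (N + 2) → ℝ) (t : ℝ)
    (ht : ∀ i : Fin (N + 2), 5 ≤ i.val → x i = t) :
    ∑ j, pSomborMatrix (graphB3 (N + 2)) p (vtx hN 0) j * x j =
      wt p N 4 * x (vtx hN 1) + wt p N 2 * (x (vtx hN 2) + x (vtx hN 3)) +
        ((N : ℝ) - 3) * (wt p N 1 * t) := by
  rw [sum_pSomborMatrix_mul x {vtx hN 1, vtx hN 2, vtx hN 3} ?_ (wt p N 1 * t) ?_]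
  · rw [Finset.sum_insert (by simp [vtx]), Finset.sum_insert (by simp [vtx]),
      Finset.sum_singleton, Finset.card_insert_of_notMem (by simp [vtx]),
      Finset.card_insert_of_notMem (by simp [vtx]), Finset.card_singleton,
      pSomborMatrix_graphB3 hN (by simp [graphB3_adj, vtx]),
      pSomborMatrix_graphB3 hN (by simp [graphB3_adj, vtx]),
      pSomborMatrix_graphB3 hN (by simp [graphB3_adj, vtx]), deg_graphB3 (by omega)]
    simp [degB3, vtx]
    ring
  · simp [graphB3_adj, vtx]
  · intro j hj hjs
    rw [pSomborMatrix_graphB3 hN hj]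
    have h5 : 5 ≤ j.val := by
      simp only [graphB3_adj, Finset.mem_insert, Finset.mem_singleton, not_or, ne_eq,
        Fin.ext_iff, val_vtx hN] at hj hjs
      omega
    rw [ht j h5]
    simp [degB3, vtx, show j.val ≠ 0 by omega, show j.val ≠ 1 by omega, show j.val ≠ 2 by omega,
      show j.val ≠ 3 by omega]

theorem graphB3_row_one (hN : 4 ≤ N) (x : Fin (N + 2) → ℝ) :
    ∑ j, pSomborMatrix (graphB3 (N + 2)) p (vtx hN 1) j * x j =
      wt p N 4 * x (vtx hN 0) + wt p 4 2 * (x (vtx hN 2) + x (vtx hN 3)) +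
        wt p 4 1 * x (vtx hN 4) := by
  rw [sum_pSomborMatrix_mul x {vtx hN 0, vtx hN 2, vtx hN 3, vtx hN 4} ?_ 0 ?_]
  · rw [Finset.sum_insert (by simp [vtx]), Finset.sum_insert (by simp [vtx]),
      Finset.sum_insert (by simp [vtx]), Finset.sum_singleton,
      pSomborMatrix_graphB3 hN (by simp [graphB3_adj, vtx]),
      pSomborMatrix_graphB3 hN (by simp [graphB3_adj, vtx]),
      pSomborMatrix_graphB3 hN (by simp [graphB3_adj, vtx]),
      pSomborMatrix_graphB3 hN (by simp [graphB3_adj, vtx])]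
    simp [degB3, vtx, wt_comm p 4 N]
    ring
  · simp [graphB3_adj, vtx]
  · intro j hj hjs
    simp only [graphB3_adj, Finset.mem_insert, Finset.mem_singleton, not_or, ne_eq,
        Fin.ext_iff, val_vtx hN] at hj hjs
    omega

theorem graphB3_row_middle (hN : 4 ≤ N) (x : Fin (N + 2) → ℝ) {k : Fin 5} (hk : k = 2 ∨ k = 3) :
    ∑ j, pSomborMatrix (graphB3 (N + 2)) p (vtx hN k) j * x j =
      wt p N 2 * x (vtx hN 0) + wt p 4 2 * x (vtx hN 1) := by
  rw [sum_pSomborMatrix_mul x {vtx hN 0, vtx hN 1} ?_ 0 ?_]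
  · rcases hk with rfl | rfl <;>
    · rw [Finset.sum_insert (by simp [vtx]), Finset.sum_singleton,
        pSomborMatrix_graphB3 hN (by simp [graphB3_adj, vtx]),
        pSomborMatrix_graphB3 hN (by simp [graphB3_adj, vtx])]
      simp [degB3, vtx, wt_comm p 2]
  · rcases hk with rfl | rfl <;> simp [graphB3_adj, vtx]
  · intro j hj hjs
    rcases hk with rfl | rfl <;>
      simp only [graphB3_adj, Finset.mem_insert, Finset.mem_singleton, not_or, ne_eq,
        Fin.ext_iff, val_vtx hN] at hj hjs <;> omega

theorem graphB3_row_four (hN : 4 ≤ N) (x : Fin (N + 2) → ℝ) :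
    ∑ j, pSomborMatrix (graphB3 (N + 2)) p (vtx hN 4) j * x j = wt p 4 1 * x (vtx hN 1) := by
  rw [sum_pSomborMatrix_mul_pendant x (j := vtx hN 1), deg_graphB3 (by omega)]
  · simp [degB3, vtx]
  · intro k
    simp only [graphB3_adj, ne_eq, Fin.ext_iff, val_vtx hN]
    grind

theorem graphB3_row_pendant (hN : 4 ≤ N) (x : Fin (N + 2) → ℝ) {i : Fin (N + 2)}
    (hi : 5 ≤ i.val) :
    ∑ j, pSomborMatrix (graphB3 (N + 2)) p i j * x j = wt p N 1 * x (vtx hN 0) := by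
  rw [sum_pSomborMatrix_mul_pendant x (j := vtx hN 0), deg_graphB3 (by omega)]
  · simp [degB3, vtx]
  · intro k
    simp only [graphB3_adj, ne_eq, Fin.ext_iff, val_vtx hN]
    omega

theorem graphB2_row_zero (hN : 4 ≤ N) (x : Fin (N + 2) → ℝ) (t : ℝ)
    (ht : ∀ i : Fin (N + 2), 5 ≤ i.val → x i = t) :
    ∑ j, pSomborMatrix (graphB2 (N + 2)) p (vtx hN 0) j * x j =
      wt p (N + 1) 2 * (x (vtx hN 1) + x (vtx hN 2) + x (vtx hN 3) + x (vtx hN 4)) +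
        ((N : ℝ) - 3) * (wt p (N + 1) 1 * t) := by
  rw [sum_pSomborMatrix_mul x {vtx hN 1, vtx hN 2, vtx hN 3, vtx hN 4} ?_ (wt p (N + 1) 1 * t) ?_]
  · rw [Finset.sum_insert (by simp [vtx]), Finset.sum_insert (by simp [vtx]),
      Finset.sum_insert (by simp [vtx]),
      Finset.sum_singleton, Finset.card_insert_of_notMem (by simp [vtx]),
      Finset.card_insert_of_notMem (by simp [vtx]),
      Finset.card_insert_of_notMem (by simp [vtx]), Finset.card_singleton,
      pSomborMatrix_graphB2 hN (by simp [graphB2_adj, vtx]),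
      pSomborMatrix_graphB2 hN (by simp [graphB2_adj, vtx]),
      pSomborMatrix_graphB2 hN (by simp [graphB2_adj, vtx]),
      pSomborMatrix_graphB2 hN (by simp [graphB2_adj, vtx]), deg_graphB2 (by omega)]
    simp [degB2, vtx]
    ring
  · simp [graphB2_adj, vtx]
  · intro j hj hjs
    rw [pSomborMatrix_graphB2 hN hj]
    have h5 : 5 ≤ j.val := by
      simp only [graphB2_adj, Finset.mem_insert, Finset.mem_singleton, not_or, ne_eq,
        Fin.ext_iff, val_vtx hN] at hj hjs
      omega
    rw [ht j h5]
    simp [degB2, vtx, show j.val ≠ 0 by omega, show j.val ≠ 1 by omega, show j.val ≠ 2 by omega,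
      show j.val ≠ 3 by omega, show j.val ≠ 4 by omega]

/-- The rows of the matrix of `B₂` at the vertices `1, 2, 3, 4`; here `k` and `l` are adjacent. -/
theorem graphB2_row_triangle (hN : 4 ≤ N) (x : Fin (N + 2) → ℝ) {k l : Fin 5}
    (hkl : (k = 1 ∧ l = 2) ∨ (k = 2 ∧ l = 1) ∨ (k = 3 ∧ l = 4) ∨ (k = 4 ∧ l = 3)) :
    ∑ j, pSomborMatrix (graphB2 (N + 2)) p (vtx hN k) j * x j =
      wt p (N + 1) 2 * x (vtx hN 0) + wt p 2 2 * x (vtx hN l) := by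
  rw [sum_pSomborMatrix_mul x {vtx hN 0, vtx hN l} ?_ 0 ?_]
  · rcases hkl with ⟨rfl, rfl⟩ | ⟨rfl, rfl⟩ | ⟨rfl, rfl⟩ | ⟨rfl, rfl⟩ <;>
    · rw [Finset.sum_insert (by simp [vtx]), Finset.sum_singleton,
        pSomborMatrix_graphB2 hN (by simp [graphB2_adj, vtx]),
        pSomborMatrix_graphB2 hN (by simp [graphB2_adj, vtx])]
      simp [degB2, vtx, wt_comm p 2]
  · rcases hkl with ⟨rfl, rfl⟩ | ⟨rfl, rfl⟩ | ⟨rfl, rfl⟩ | ⟨rfl, rfl⟩ <;> simp [graphB2_adj, vtx]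
  · intro j hj hjs
    rcases hkl with ⟨rfl, rfl⟩ | ⟨rfl, rfl⟩ | ⟨rfl, rfl⟩ | ⟨rfl, rfl⟩ <;>
      simp only [graphB2_adj, Finset.mem_insert, Finset.mem_singleton, not_or, ne_eq,
        Fin.ext_iff, val_vtx hN] at hj hjs <;> omega

theorem graphB2_row_pendant (hN : 4 ≤ N) (x : Fin (N + 2) → ℝ) {i : Fin (N + 2)}
    (hi : 5 ≤ i.val) :
    ∑ j, pSomborMatrix (graphB2 (N + 2)) p i j * x j = wt p (N + 1) 1 * x (vtx hN 0) := by
  rw [sum_pSomborMatrix_mul_pendant x (j := vtx hN 0), deg_graphB2 (by omega)]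
  · simp [degB2, vtx]
  · intro k
    simp only [graphB2_adj, ne_eq, Fin.ext_iff, val_vtx hN]
    omega

end ExtremalRows

/-! ### The kite -/

section Kite

variable {V : Type*} {G : SimpleGraph V} {p : ℝ} {N : ℕ} {v u w a : V}

theorem IsKite.not_adj (h : IsKite G v u w a) : ¬ G.Adj v a := fun hva => by
  rcases (h.adj_a v).1 hva.symm with e | e
  · exact h.adj_vu.ne e
  · exact h.adj_vw.ne e

theorem IsKite.adj_of_ne (h : IsKite G v u w a) {j : V} (hjv : j ≠ v) (hja : j ≠ a) :
    G.Adj v j := by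
  by_cases hju : j = u
  · exact hju ▸ h.adj_vu
  by_cases hjw : j = w
  · exact hjw ▸ h.adj_vw
  exact ((h.pendant j hjv hju hjw hja v).2 rfl).symm

variable [Fintype V]

theorem IsKite.deg_a (h : IsKite G v u w a) : deg G a = 2 := by
  classical
  rw [deg, Finset.card_eq_two]
  exact ⟨u, w, h.adj_uw.ne, by ext k; simp [h.adj_a]⟩

theorem IsKite.deg_u (h : IsKite G v u w a) : deg G u = 3 := by
  classical
  rw [deg, Finset.card_eq_three]
  exact ⟨v, w, a, h.adj_vw.ne, h.ne.symm, ((h.adj_a w).2 (Or.inr rfl)).ne',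
    by ext k; simp [h.adj_u]⟩

theorem IsKite.deg_w (h : IsKite G v u w a) : deg G w = 3 := by
  classical
  rw [deg, Finset.card_eq_three]
  exact ⟨v, u, a, h.adj_vu.ne, h.ne.symm, ((h.adj_a u).2 (Or.inl rfl)).ne',
    by ext k; simp [h.adj_w]⟩

theorem IsKite.deg_v (h : IsKite G v u w a) (hV : Fintype.card V = N + 2) : deg G v = N := by
  classical
  have : Finset.univ.filter (G.Adj v) = (Finset.univ.erase v).erase a := by
    ext k
    simp only [Finset.mem_filter, Finset.mem_univ, true_and, Finset.mem_erase, and_true]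
    exact ⟨fun hk => ⟨fun e => h.not_adj (e ▸ hk), hk.ne'⟩, fun hk => h.adj_of_ne hk.2 hk.1⟩
  have hcard := congrArg Finset.card this
  rw [Finset.card_erase_of_mem (by simp [h.ne]), Finset.card_erase_of_mem (Finset.mem_univ _),
    Finset.card_univ, hV] at hcard
  rw [deg]
  convert hcard using 1
  omega

/-- The eigenvalue equations of a kite for a positive Perron vector, in which the two vertices of
degree three have the same weight `y`; the centre has weight `z` and the fourth vertex of the `K₄`
minus an edge has weight `s`. -/
theorem IsKite.exists_weights (hN : 4 ≤ N) (h : IsKite G v u w a) (hV : Fintype.card V = N + 2)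
    (hG : G.Connected) : ∃ z y s : ℝ, 0 < z ∧ 0 < y ∧ 0 < pSomborRadius G p ∧
      pSomborRadius G p * z = 2 * wt p N 3 * y +
        ((N : ℝ) - 2) * (wt p N 1 * (wt p N 1 * z / pSomborRadius G p)) ∧
      pSomborRadius G p * y = wt p N 3 * z + wt p 3 3 * y + wt p 3 2 * s ∧
      pSomborRadius G p * s = 2 * wt p 3 2 * y := by
  classical
  obtain ⟨x, hx, hS⟩ := exists_perron_vector (p := p) hG
  have : Nontrivial V := Fintype.one_lt_card_iff_nontrivial.1 (by omega)
  have hr := pSomborRadius_pos (p := p) hG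
  set r := pSomborRadius G p
  have dv := h.deg_v hV
  have hau : G.Adj a u := (h.adj_a u).2 (Or.inl rfl)
  have haw : G.Adj a w := (h.adj_a w).2 (Or.inr rfl)
  have eu : r * x u = wt p N 3 * x v + wt p 3 3 * x w + wt p 3 2 * x a := by
    rw [← hS u, sum_pSomborMatrix_mul x {v, w, a} (by simp [h.adj_u]) 0
      fun j hj hjs => (hjs (by simpa using (h.adj_u j).1 hj)).elim,
      Finset.sum_insert (by simp [h.adj_vw.ne, h.ne.symm]),
      Finset.sum_insert (by simp [haw.ne']), Finset.sum_singleton,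
      pSomborMatrix_of_adj h.adj_vu.symm, pSomborMatrix_of_adj h.adj_uw,
      pSomborMatrix_of_adj hau.symm, h.deg_u, h.deg_w, h.deg_a, dv, wt_comm p N]
    push_cast
    ring
  have ew : r * x w = wt p N 3 * x v + wt p 3 3 * x u + wt p 3 2 * x a := by
    rw [← hS w, sum_pSomborMatrix_mul x {v, u, a} (by simp [h.adj_w]) 0
      fun j hj hjs => (hjs (by simpa using (h.adj_w j).1 hj)).elim,
      Finset.sum_insert (by simp [h.adj_vu.ne, h.ne.symm]),
      Finset.sum_insert (by simp [hau.ne']), Finset.sum_singleton,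
      pSomborMatrix_of_adj h.adj_vw.symm, pSomborMatrix_of_adj h.adj_uw.symm,
      pSomborMatrix_of_adj haw.symm, h.deg_u, h.deg_w, h.deg_a, dv, wt_comm p N]
    push_cast
    ring
  have ea : r * x a = wt p 3 2 * x u + wt p 3 2 * x w := by
    rw [← hS a, sum_pSomborMatrix_mul x {u, w} (by simp [h.adj_a]) 0
      fun j hj hjs => (hjs (by simpa using (h.adj_a j).1 hj)).elim,
      Finset.sum_insert (by simp [h.adj_uw.ne]), Finset.sum_singleton,
      pSomborMatrix_of_adj hau, pSomborMatrix_of_adj haw, h.deg_u, h.deg_w, h.deg_a]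
    push_cast
    rw [wt_comm p 2]
    ring
  have ev : r * x v = wt p N 3 * x u + wt p N 3 * x w +
      ((N : ℝ) - 2) * (wt p N 1 * (wt p N 1 * x v / r)) := by
    rw [← hS v, sum_pSomborMatrix_mul x {u, w} (by simp [h.adj_vu, h.adj_vw])
      (wt p N 1 * (wt p N 1 * x v / r)) fun j hj hjs => ?_,
      Finset.sum_insert (by simp [h.adj_uw.ne]), Finset.sum_singleton,
      pSomborMatrix_of_adj h.adj_vu, pSomborMatrix_of_adj h.adj_vw, h.deg_u, h.deg_w, dv,
      Finset.card_pair h.adj_uw.ne]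
    · push_cast
      ring
    · simp only [Finset.mem_insert, Finset.mem_singleton, not_or] at hjs
      have hk := h.pendant j hj.ne' hjs.1 hjs.2 fun e => h.not_adj (e ▸ hj)
      have h1 := hS j
      rw [sum_pSomborMatrix_mul_pendant x hk, dv] at h1
      rw [pSomborMatrix_of_adj hj, deg_eq_one hk, Nat.cast_one, dv, h1,
        mul_div_cancel_left₀ _ hr.ne']
  have hw33 : 0 < wt p 3 3 := wt_pos_left (by norm_num) (by norm_num)
  have huw : x u = x w := by
    have : (r + wt p 3 3) * (x u - x w) = 0 := by linear_combination eu - ew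
    rcases mul_eq_zero.1 this with h0 | h0 <;> linarith
  rw [← huw] at ea ev eu
  exact ⟨x v, x u, x a, hx v, hx u, hr, by linarith, eu, by linarith⟩

/-- The kite has a smaller spectral radius than `B₃`.  The trial vector arises from
the Perron vector of the kite by regarding `B₃` as the kite with the edge `w a` replaced by an edge
from `u` to a pendent vertex: only `a`, which becomes the pendent vertex at the hub `1`, gets a new
weight, the one that solves its equation. -/
theorem IsKite.lt_graphB3 (hN : 4 ≤ N) (hp : 2 ≤ p) (h : IsKite G v u w a)
    (hV : Fintype.card V = N + 2) (hG : G.Connected) :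
    pSomborRadius G p < pSomborRadius (graphB3 (N + 2)) p := by
  obtain ⟨z, y, s, hz, hy, hr, ez, ey, es⟩ := h.exists_weights (p := p) hN hV hG
  set r := pSomborRadius G p
  have hNR : (4 : ℝ) ≤ N := by exact_mod_cast hN
  have hN0 : (0 : ℝ) ≤ N := by linarith
  have hp0 : 0 < p := by linarith
  have hp1 : 1 ≤ p := by linarith
  have pos : ∀ b : ℝ, 0 ≤ b → 0 < wt p N b := fun b hb => wt_pos_left (by linarith) hb
  set t := wt p N 1 * z / r with ht
  set q := wt p 4 1 * y / r with hq
  have hrt : r * t = wt p N 1 * z := by rw [ht]; field_simp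
  have hrq : r * q = wt p 4 1 * y := by rw [hq]; field_simp
  have key := kite_inequality (N := N) (r := r) (z := z) (y := y) (F := wt p N 3) (g := wt p 3 3)
    (h := wt p 3 2) (τ := wt p N 1) (b := wt p 4 2) (c := wt p 4 1) hNR hr hz hy
    (pos _ (by norm_num))
    (wt_pos_left (by norm_num) (by norm_num)) (wt_pos_left (by norm_num) (by norm_num))
    (pos _ (by norm_num)) (wt_pos_left (by norm_num) (by norm_num))
    (by linear_combination r * ez + ((N : ℝ) - 2) * wt p N 1 * hrt)
    (by linear_combination r * ey + wt p 3 2 * es)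
    (wt_sq_le hp hN0 (by norm_num) hN0 (by norm_num) (by norm_num) (by nlinarith) (by nlinarith)
      (by nlinarith))
    (by have := wt_sq_le (a := 3) (b := 2) (c := 4) (d := 2) (K := 13 / 20) hp (by norm_num)
          (by norm_num) (by norm_num) (by norm_num) (by norm_num) (by norm_num) (by norm_num)
          (by norm_num)
        linarith)
    (wt_sq_le hp (by norm_num) (by norm_num) (by norm_num) (by norm_num) (by norm_num)
      (by norm_num) (by norm_num) (by norm_num))
    (wt_le_wt hp0 (by norm_num) (by norm_num) (by norm_num) (by norm_num))
    (by have := wt_sq_le (a := 3) (b := 2) (c := 4) (d := 1) (K := 13 / 17) hp (by norm_num)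
          (by norm_num) (by norm_num) (by norm_num) (by norm_num) (by norm_num) (by norm_num)
          (by norm_num)
        linarith)
    (by have := wt_sq_le (a := 3) (b := 2) (c := N) (d := 3) (K := 9 / 16) hp (by norm_num)
          (by norm_num) hN0 (by norm_num) (by norm_num) (by nlinarith) (by nlinarith)
          (by nlinarith)
        linarith)
    (by have := wt_sq_le (a := 3) (b := 2) (c := N) (d := 1) (K := 13 / 17) hp (by norm_num)
          (by norm_num) hN0 (by norm_num) (by norm_num) (by nlinarith) (by nlinarith)
          (by nlinarith)
        linarith)
  let x : Fin (N + 2) → ℝ := fun i =>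
    if i.val = 0 then z else if i.val = 1 ∨ i.val = 2 then y else if i.val = 4 then q else t
  have x0 : x (vtx hN 0) = z := rfl
  have x1 : x (vtx hN 1) = y := rfl
  have x2 : x (vtx hN 2) = y := rfl
  have x3 : x (vtx hN 3) = t := rfl
  have x4 : x (vtx hN 4) = q := rfl
  have x5 : ∀ i : Fin (N + 2), 5 ≤ i.val → x i = t := fun i hi => by
    simp only [x]
    rw [if_neg (by omega), if_neg (by omega), if_neg (by omega)]
  refine lt_pSomborRadius_of_sum x {vtx hN 0, vtx hN 1, vtx hN 2, vtx hN 3} (fun i hi => ?_) ?_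
  · by_cases hi4 : i.val = 4
    · have : i = vtx hN 4 := Fin.ext hi4
      rw [this, graphB3_row_four, x4, x1, hrq]
    · have h5 : 5 ≤ i.val := by
        simp only [Finset.mem_insert, Finset.mem_singleton, not_or, Fin.ext_iff, val_vtx hN] at hi
        omega
      rw [graphB3_row_pendant hN x h5, x5 i h5, x0, hrt]
  · rw [Finset.sum_insert (by simp [vtx]), Finset.sum_insert (by simp [vtx]),
      Finset.sum_insert (by simp [vtx]), Finset.sum_singleton, graphB3_row_zero hN x t x5,
      graphB3_row_one, graphB3_row_middle hN x (Or.inl rfl), graphB3_row_middle hN x (Or.inr rfl),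
      x0, x1, x2, x3, x4]
    -- the three parts of the gain: replacing the degrees `3, 3` of the neighbours of the centre by
    -- `4, 2`, raising the degree of a pendent vertex, and the gain inside the `K₄` minus an edge
    have g1 : 0 ≤ wt p N 4 + wt p N 2 - 2 * wt p N 3 := by
      have := wt_increment_le (b := N) (x := 2) (y := 3) (k := 1) hp1 hN0 (by norm_num)
        (by norm_num) (by norm_num)
      norm_num at this
      rw [wt_comm p 2, wt_comm p 3, wt_comm p 4] at this
      linarith
    have g2 : 0 ≤ wt p N 2 - wt p N 1 :=
      sub_nonneg.2 (wt_le_wt hp0 hN0 (by norm_num) le_rfl (by norm_num))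
    have ht0 : 0 < t := div_pos (mul_pos (pos 1 (by norm_num)) hz) hr
    have e1 := mul_nonneg g1 (mul_pos hz hy).le
    have e2 := mul_nonneg g2 (mul_pos hz ht0).le
    have e3 : wt p 4 1 * q = wt p 4 1 ^ 2 * y / r := by rw [hq]; ring
    have e4 : s = 2 * wt p 3 2 * y / r := by rw [← es]; field_simp
    have e5 := div_pos (mul_pos key (mul_pos two_pos hy)) hr
    have e6 : (wt p 4 2 * wt p N 1 * z + r * (wt p 4 2 - wt p 3 3) * y +
        (wt p 4 1 ^ 2 / 2 - 2 * wt p 3 2 ^ 2) * y) * (2 * y) / r =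
        2 * wt p 4 2 * t * y + 2 * (wt p 4 2 - wt p 3 3) * y ^ 2 + wt p 4 1 * q * y -
          2 * wt p 3 2 * s * y := by
      rw [e3, e4, ht]
      field_simp
      ring
    rw [e6] at e5
    have f1 : r * z = 2 * wt p N 3 * y + ((N : ℝ) - 2) * (wt p N 1 * t) := ez
    linear_combination e5 + 2 * e1 + 2 * e2 + z * f1 + 2 * y * ey + t * hrt
end Kite

/-! ### Comparison of `B₁`, `B₂`, `B₃` and all other bicyclic graphs -/

section Top

variable {N : ℕ} {p : ℝ}

/-- The eigenvalue equations of `B₃` for the Perron weights `z`, `y` of its hubs `0` and `1`, after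
elimination of the other weights. -/
theorem graphB3_hub_equations (hN : 4 ≤ N) : ∃ z y : ℝ, 0 < z ∧ 0 < y ∧
    0 < pSomborRadius (graphB3 (N + 2)) p ∧
    pSomborRadius (graphB3 (N + 2)) p ^ 2 * z = wt p N 4 * pSomborRadius (graphB3 (N + 2)) p * y +
      2 * wt p N 2 * (wt p N 2 * z + wt p 4 2 * y) + ((N : ℝ) - 3) * wt p N 1 ^ 2 * z ∧
    pSomborRadius (graphB3 (N + 2)) p ^ 2 * y = wt p N 4 * pSomborRadius (graphB3 (N + 2)) p * z +
      2 * wt p 4 2 * (wt p N 2 * z + wt p 4 2 * y) + wt p 4 1 ^ 2 * y := by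
  have hG := (isBicyclic_graphB3 (n := N + 2) (by omega)).1
  obtain ⟨x, hx, hS⟩ := exists_perron_vector (p := p) hG
  have hr := pSomborRadius_pos (p := p) hG
  set r := pSomborRadius (graphB3 (N + 2)) p
  have h0 := hS (vtx hN 0)
  have h1 := hS (vtx hN 1)
  have h2 := hS (vtx hN 2)
  have h3 := hS (vtx hN 3)
  have h4 := hS (vtx hN 4)
  have h5 : ∀ i : Fin (N + 2), 5 ≤ i.val → x i = wt p N 1 * x (vtx hN 0) / r := fun i hi => by
    rw [← graphB3_row_pendant hN x hi, hS i, mul_div_cancel_left₀ _ hr.ne']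
  rw [graphB3_row_zero hN x _ h5] at h0
  rw [graphB3_row_one] at h1
  rw [graphB3_row_middle hN x (Or.inl rfl)] at h2
  rw [graphB3_row_middle hN x (Or.inr rfl)] at h3
  rw [graphB3_row_four] at h4
  have e : r * (wt p N 1 * x (vtx hN 0) / r) = wt p N 1 * x (vtx hN 0) := by field_simp
  refine ⟨x (vtx hN 0), x (vtx hN 1), hx _, hx _, hr, ?_, ?_⟩
  · linear_combination (-r) * h0 - wt p N 2 * h2 - wt p N 2 * h3 + ((N : ℝ) - 3) * wt p N 1 * e
  · linear_combination (-r) * h1 - wt p 4 2 * h2 - wt p 4 2 * h3 - wt p 4 1 * h4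

/-- A lower bound for the spectral radius of `B₂`, from the trial vector that solves the eigenvalue
equation for `r` outside the centre. -/
theorem lt_pSomborRadius_graphB2 (hN : 4 ≤ N) {r : ℝ} (hr : wt p 2 2 < r)
    (h : r ^ 2 * (r - wt p 2 2) <
      4 * wt p (N + 1) 2 ^ 2 * r + ((N : ℝ) - 3) * wt p (N + 1) 1 ^ 2 * (r - wt p 2 2)) :
    r < pSomborRadius (graphB2 (N + 2)) p := by
  have hg : 0 < wt p 2 2 := wt_pos_left (by norm_num) (by norm_num)
  have hr0 : 0 < r := hg.trans hr
  have hrg : 0 < r - wt p 2 2 := sub_pos.2 hr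
  set s := wt p (N + 1) 2 / (r - wt p 2 2) with hs
  set t := wt p (N + 1) 1 / r with ht
  have hs' : (r - wt p 2 2) * s = wt p (N + 1) 2 := by rw [hs]; field_simp
  have ht' : r * t = wt p (N + 1) 1 := by rw [ht]; field_simp
  let x : Fin (N + 2) → ℝ := fun i => if i.val = 0 then 1 else if i.val ≤ 4 then s else t
  have x0 : x (vtx hN 0) = 1 := rfl
  have x1 : x (vtx hN 1) = s := rfl
  have x2 : x (vtx hN 2) = s := rfl
  have x3 : x (vtx hN 3) = s := rfl
  have x4 : x (vtx hN 4) = s := rfl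
  have x5 : ∀ i : Fin (N + 2), 5 ≤ i.val → x i = t := fun i hi => by
    simp only [x]
    rw [if_neg (by omega), if_neg (by omega)]
  refine lt_pSomborRadius_of_sum x {vtx hN 0} (fun i hi => ?_) ?_
  · have main : i.val = 0 ∨ i.val = 1 ∨ i.val = 2 ∨ i.val = 3 ∨ i.val = 4 ∨ 5 ≤ i.val := by omega
    rcases main with h | h | h | h | h | h
    · exact (hi (by rw [Finset.mem_singleton]; exact Fin.ext h)).elim
    · rw [show i = vtx hN 1 from Fin.ext h, graphB2_row_triangle hN x (l := 2) (by simp), x0, x1,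
        x2]
      linear_combination -hs'
    · rw [show i = vtx hN 2 from Fin.ext h, graphB2_row_triangle hN x (l := 1) (by simp), x0, x1,
        x2]
      linear_combination -hs'
    · rw [show i = vtx hN 3 from Fin.ext h, graphB2_row_triangle hN x (l := 4) (by simp), x0, x3,
        x4]
      linear_combination -hs'
    · rw [show i = vtx hN 4 from Fin.ext h, graphB2_row_triangle hN x (l := 3) (by simp), x0, x3,
        x4]
      linear_combination -hs'
    · rw [graphB2_row_pendant hN x h, x0, x5 i h, ht', mul_one]
  · rw [Finset.sum_singleton, graphB2_row_zero hN x t x5, x0, x1, x2, x3, x4]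
    have e : 0 < (4 * wt p (N + 1) 2 ^ 2 * r + ((N : ℝ) - 3) * wt p (N + 1) 1 ^ 2 *
        (r - wt p 2 2) - r ^ 2 * (r - wt p 2 2)) / (r * (r - wt p 2 2)) :=
      div_pos (by linarith) (by positivity)
    convert e using 1
    rw [hs, ht]
    field_simp
    ring

/-- If the spectral radius of `B₃` were at least that of `B₂`, the trial vector on `B₂` would bound
it from below by more than the hub equations of `B₃` allow. -/
theorem graphB3_lt_graphB2 (hN : 4 ≤ N) (hp : 2 ≤ p) :
    pSomborRadius (graphB3 (N + 2)) p < pSomborRadius (graphB2 (N + 2)) p := by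
  obtain ⟨z, y, hz, hy, hr, h1, h2⟩ := graphB3_hub_equations (p := p) hN
  set r := pSomborRadius (graphB3 (N + 2)) p
  have hNR : (4 : ℝ) ≤ N := by exact_mod_cast hN
  have hN0 : (0 : ℝ) ≤ N := by linarith
  have hp0 : 0 < p := by linarith
  have hg : 0 < wt p 2 2 := wt_pos_left (by norm_num) (by norm_num)
  have hE : 0 < wt p N 4 := wt_pos_right hN0 (by norm_num)
  have hB : 0 < wt p N 2 := wt_pos_right hN0 (by norm_num)
  have hb : 0 < wt p 4 2 := wt_pos_right (by norm_num) (by norm_num)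
  have hc : 0 < wt p 4 1 := wt_pos_right (by norm_num) (by norm_num)
  obtain ⟨hPQ, hQ⟩ := eliminate_hubs hz hy hr hE hB hb h1 h2
  have hgr : wt p 2 2 < r := by
    have e1 : wt p 2 2 ≤ wt p 4 2 := wt_le_wt hp0 (by norm_num) (by norm_num) (by norm_num) le_rfl
    have e2 : wt p 4 2 ^ 2 < r ^ 2 := by nlinarith
    exact e1.trans_lt (lt_of_pow_lt_pow_left₀ 2 hr.le e2)
  refine lt_pSomborRadius_graphB2 hN hgr ?_
  by_contra! hcon
  have hb2 : wt p 4 2 ^ 2 ≤ 20 := by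
    have := wt_sq_le_sq_add_sq (a := 4) (b := 2) hp (by norm_num) (by norm_num)
    linarith
  have hc2 : wt p 4 1 ^ 2 ≤ 17 := by
    have := wt_sq_le_sq_add_sq (a := 4) (b := 1) hp (by norm_num) (by norm_num)
    linarith
  have hsq : 4 * wt p (N + 1) 2 ^ 2 + ((N : ℝ) - 3) * wt p (N + 1) 1 ^ 2 ≤ r ^ 2 :=
    le_sq_of_cubic_le hg hgr (by positivity) hcon
  have main : N = 4 ∨ N = 5 ∨ 6 ≤ N := by omega
  rcases main with rfl | rfl | hN6
  · have e22 : wt p 2 2 = wt p 4 4 / 2 := by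
      have := mul_wt (p := p) (k := 2) (a := 2) (b := 2) hp0 (by norm_num) (by norm_num)
        (by norm_num)
      norm_num at this
      linarith
    norm_num at hPQ hcon
    rw [e22] at hcon
    refine radius_inequality_six (r := r) (a := wt p 4 4) (b := wt p 4 2) (c := wt p 4 1)
      (B' := wt p 5 2) (τ' := wt p 5 1) hr (wt_pos_left (by norm_num) (by norm_num)) hb
      (by linear_combination hPQ) hQ (by linarith)
      (wt_sq_le hp (by norm_num) (by norm_num) (by norm_num) (by norm_num) (by norm_num)
        (by norm_num) (by norm_num) (by norm_num)) ?_ hc2 ?_ hb2 ?_ ?_ ?_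
    · have := le_wt_left (a := 4) (b := 1) hp0 (by norm_num) (by norm_num)
      nlinarith
    · have := le_wt_left (a := 4) (b := 2) hp0 (by norm_num) (by norm_num)
      nlinarith
    · have := wt_sq_le (a := 4) (b := 2) (c := 5) (d := 2) (K := 20 / 29) hp (by norm_num)
        (by norm_num) (by norm_num) (by norm_num) (by norm_num) (by norm_num) (by norm_num)
        (by norm_num)
      linarith
    · have := wt_sq_le (a := 4) (b := 1) (c := 5) (d := 1) (K := 17 / 26) hp (by norm_num)
        (by norm_num) (by norm_num) (by norm_num) (by norm_num) (by norm_num) (by norm_num)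
        (by norm_num)
      linarith
    · have := wt_sq_le_sq_add_sq (a := 5) (b := 1) hp (by norm_num) (by norm_num)
      linarith
  · norm_num at hPQ hsq
    refine radius_inequality_seven (r := r) (E := wt p 5 4) (B := wt p 5 2) (τ := wt p 5 1)
      (b := wt p 4 2) (c := wt p 4 1) (B' := wt p 6 2) (τ' := wt p 6 1) hr
      (wt_pos_left (by norm_num) (by norm_num)) (wt_pos_left (by norm_num) (by norm_num)) hb
      (by linear_combination hPQ) hsq
      (wt_sq_le hp (by norm_num) (by norm_num) (by norm_num) (by norm_num) (by norm_num)
        (by norm_num) (by norm_num) (by norm_num))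
      (wt_sq_le hp (by norm_num) (by norm_num) (by norm_num) (by norm_num) (by norm_num)
        (by norm_num) (by norm_num) (by norm_num))
      (pow_le_pow_left₀ hc.le (wt_le_wt hp0 (by norm_num) (by norm_num) le_rfl (by norm_num)) 2)
      ?_ ?_ ?_
    · have := wt_sq_le (a := 5) (b := 2) (c := 5) (d := 1) (K := 29 / 26) hp (by norm_num)
        (by norm_num) (by norm_num) (by norm_num) (by norm_num) (by norm_num) (by norm_num)
        (by norm_num)
      linarith
    · have := wt_sq_le (a := 5) (b := 2) (c := 6) (d := 2) (K := 29 / 40) hp (by norm_num)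
        (by norm_num) (by norm_num) (by norm_num) (by norm_num) (by norm_num) (by norm_num)
        (by norm_num)
      linarith
    · have := wt_sq_le (a := 5) (b := 1) (c := 6) (d := 1) (K := 26 / 37) hp (by norm_num)
        (by norm_num) (by norm_num) (by norm_num) (by norm_num) (by norm_num) (by norm_num)
        (by norm_num)
      linarith
  · have hN6R : (6 : ℝ) ≤ N := by exact_mod_cast hN6
    have sq2 : ∀ b : ℝ, 0 ≤ b → wt p N b ^ 2 ≤ (N : ℝ) ^ 2 + b ^ 2 := fun b hb =>
      wt_sq_le_sq_add_sq hp hN0 hb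
    refine radius_inequality_large (N := N) hN6R hr hE hB hb hPQ hsq ?_ ?_ ?_ hb2 hc2
      (pow_le_pow_left₀ (by linarith) (le_wt_left hp0 (by linarith) (by norm_num)) 2)
      (pow_le_pow_left₀ (by linarith) (le_wt_left hp0 (by linarith) (by norm_num)) 2)
    · have := sq2 4 (by norm_num)
      linarith
    · have := sq2 2 (by norm_num)
      linarith
    · have := sq2 1 (by norm_num)
      linarith

/-- `B₁` arises from `B₂` by a Kelmans transformation of one vertex of each triangle. -/
theorem graphB2_lt_graphB1 (hN : 4 ≤ N) (hp : 1 ≤ p) :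
    pSomborRadius (graphB2 (N + 2)) p < pSomborRadius (graphB1 (N + 2)) p := by
  have hG := (isBicyclic_graphB2 (n := N + 2) (by omega)).1
  obtain ⟨x, hx, hS⟩ := exists_perron_vector (p := p) hG
  have := hG.nonempty
  have hr := pSomborRadius_pos (p := p) hG
  have hg : 0 < wt p 2 2 := wt_pos_left (by norm_num) (by norm_num)
  have h1 := hS (vtx hN 1)
  have h2 := hS (vtx hN 2)
  have h3 := hS (vtx hN 3)
  have h4 := hS (vtx hN 4)
  rw [graphB2_row_triangle hN x (l := 2) (by simp)] at h1
  rw [graphB2_row_triangle hN x (l := 1) (by simp)] at h2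
  rw [graphB2_row_triangle hN x (l := 4) (by simp)] at h3
  rw [graphB2_row_triangle hN x (l := 3) (by simp)] at h4
  have hB : 0 < wt p (N + 1) 2 := wt_pos_left (by positivity) (by norm_num)
  set r := pSomborRadius (graphB2 (N + 2)) p
  have e12 : x (vtx hN 1) = x (vtx hN 2) := by
    have : (r + wt p 2 2) * (x (vtx hN 1) - x (vtx hN 2)) = 0 := by linear_combination h2 - h1
    rcases mul_eq_zero.1 this with h0 | h0 <;> linarith
  have e34 : x (vtx hN 3) = x (vtx hN 4) := by
    have : (r + wt p 2 2) * (x (vtx hN 3) - x (vtx hN 4)) = 0 := by linear_combination h4 - h3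
    rcases mul_eq_zero.1 this with h0 | h0 <;> linarith
  have e14 : x (vtx hN 4) ≤ x (vtx hN 1) := by
    have h5 : (r - wt p 2 2) * (x (vtx hN 1) - x (vtx hN 4)) = 0 := by
      rw [← e12] at h1
      rw [e34] at h4
      linear_combination h4 - h1
    have h6 : 0 < (r - wt p 2 2) * x (vtx hN 1) := by
      have := mul_pos hB (hx (vtx hN 0))
      rw [← e12] at h1
      linarith
    have h7 : 0 < r - wt p 2 2 := pos_of_mul_pos_left h6 (hx _).le
    rcases mul_eq_zero.1 h5 with h0 | h0 <;> linarith
  rw [← shift_graphB2 (n := N + 2) (by omega)]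
  refine pSomborRadius_lt_kelmans hp (shiftable_graphB2 (by omega)) hx hS e14
    (fun j hj1 hj2 _ => ?_) (Finset.singleton_nonempty _) (a := vtx hN 2) ?_ ?_ ?_
  · simp only [graphB2_adj, Finset.mem_singleton, ne_eq, Fin.ext_iff] at *
    omega
  all_goals simp [graphB2_adj, vtx]

end Top

section Main

variable {V : Type*} [Fintype V] {p : ℝ} {N : ℕ}

/-- A bicyclic graph without dominating vertex either admits a Kelmans transformation to another
such graph, of larger spectral radius, or is a double broom or a kite. -/
theorem IsBicyclic.step_or_terminal {G : SimpleGraph V} (hN : 4 ≤ N) (hp : 2 ≤ p)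
    (hV : Fintype.card V = N + 2) (hG : IsBicyclic G) (hdom : ∀ y, ∃ z, z ≠ y ∧ ¬ G.Adj y z)
    (h3 : ¬ Nonempty (G ≃g graphB3 (N + 2))) :
    pSomborRadius G p < pSomborRadius (graphB3 (N + 2)) p ∨
      ∃ G' : SimpleGraph V, IsBicyclic G' ∧ (∀ y, ∃ z, z ≠ y ∧ ¬ G'.Adj y z) ∧
        pSomborRadius G p < pSomborRadius G' p := by
  have hp1 : 1 ≤ p := by linarith
  by_contra! hcon
  obtain ⟨hle, hstep⟩ := hcon
  have step : ∀ u v a c : V, u ≠ v → G.Adj u a → ¬ G.Adj v a → a ≠ v → G.Adj v c →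
      ¬ G.Adj u c → c ≠ u → ((G.Adj u v ∧ ∃ y, ¬ G.Adj u y ∧ ¬ G.Adj v y) ∨
      (¬ G.Adj u v ∧ ∃ w, G.Adj u w ∧ G.Adj v w)) → False :=
    fun u v a c huv hua hva hav hvc huc hcu hy => by
      obtain ⟨G', h1, h2, h3⟩ :=
        exists_lt_of_incomparable hp1 hG hdom huv hua hva hav hvc huc hcu hy
      exact absurd h3 (not_lt.2 (hstep G' h1 h2))
  have hNest : NestedAtDistanceTwo G := fun u v w a c huv huw hvw hua hva hvc => by
    by_contra huc
    exact step u v a c (fun e => hva (e ▸ hua)) hua hva (fun e => huv (e ▸ hua)) hvc huc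
      (fun e => huv (e ▸ hvc.symm)) (Or.inr ⟨huv, w, huw, hvw⟩)
  have hSpan : NestedOrSpanning G := fun u v a c huv hua hva hav hvc huc hcu => by
    refine ⟨huv, fun y => ?_⟩
    by_contra! hy
    exact step u v a c huv.ne hua hva hav hvc huc hcu (Or.inl ⟨huv, y, hy⟩)
  have := hG.1.nonempty
  obtain ⟨u, v, a, c, huv, hua, hva, hav, hvc, huc, hcu⟩ := exists_incomparable_edge hG.1 hdom
  have hS := hSpan u v a c huv hua hva hav hvc huc hcu
  rcases hG.doubleBroom_or_kite (by omega) hS hNest hSpan hua hva hav hvc huc hcu with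
    ⟨d, e, h⟩ | ⟨_, _, _, _, h⟩
  · rcases h.lt_or_iso (n := N + 2) (by omega) hV hp1 hG hua hva hav hvc huc hcu with h | h
    · exact absurd h (not_lt.2 hle)
    · exact h3 h
  · exact absurd (h.lt_graphB3 hN hp hV hG.1) (not_lt.2 hle)

/-- `B₃` is the largest bicyclic graph without dominating vertex. -/
theorem IsBicyclic.lt_graphB3 {G : SimpleGraph V} (hN : 4 ≤ N) (hp : 2 ≤ p)
    (hV : Fintype.card V = N + 2) (hG : IsBicyclic G) (hdom : ∀ y, ∃ z, z ≠ y ∧ ¬ G.Adj y z)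
    (h3 : ¬ Nonempty (G ≃g graphB3 (N + 2))) :
    pSomborRadius G p < pSomborRadius (graphB3 (N + 2)) p := by
  classical
  -- a graph of maximal spectral radius among those that are bicyclic, have no dominating vertex
  -- and are not `B₃`
  obtain ⟨H, ⟨hH, hHdom, hH3⟩, hmax⟩ := Set.exists_max_image
    {H : SimpleGraph V | IsBicyclic H ∧ (∀ y, ∃ z, z ≠ y ∧ ¬ H.Adj y z) ∧
      ¬ Nonempty (H ≃g graphB3 (N + 2))} (fun H => pSomborRadius H p) (Set.toFinite _)
    ⟨G, hG, hdom, h3⟩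
  refine (hmax G ⟨hG, hdom, h3⟩).trans_lt ?_
  rcases hH.step_or_terminal hN hp hV hHdom hH3 with h | ⟨H', h1, h2, h4⟩
  · exact h
  · by_cases hiso : Nonempty (H' ≃g graphB3 (N + 2))
    · obtain ⟨φ⟩ := hiso
      rwa [pSomborRadius_iso φ] at h4
    · exact absurd h4 (not_lt.2 (hmax H' ⟨h1, h2, hiso⟩))

end Main

theorem mainTheorem4 (n : ℕ) (hn : 6 ≤ n) (p : ℝ) (hp : 2 ≤ p) :
    (IsBicyclic (graphB1 n) ∧ IsBicyclic (graphB2 n) ∧ IsBicyclic (graphB3 n)) ∧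
    (pSomborRadius (graphB3 n) p < pSomborRadius (graphB2 n) p ∧
      pSomborRadius (graphB2 n) p < pSomborRadius (graphB1 n) p) ∧
    ∀ (V : Type*) [Fintype V] (G : SimpleGraph V), Fintype.card V = n → IsBicyclic G →
      ¬ Nonempty (G ≃g graphB1 n) → ¬ Nonempty (G ≃g graphB2 n) →
      ¬ Nonempty (G ≃g graphB3 n) →
      pSomborRadius G p < pSomborRadius (graphB3 n) p := by
  -- `N` is the largest degree of `B₃`
  obtain ⟨N, rfl⟩ : ∃ N, n = N + 2 := ⟨n - 2, by omega⟩
  have hN : 4 ≤ N := by omega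
  refine ⟨⟨isBicyclic_graphB1 hn, isBicyclic_graphB2 hn, isBicyclic_graphB3 hn⟩,
    ⟨graphB3_lt_graphB2 hN hp, graphB2_lt_graphB1 hN (by linarith)⟩, ?_⟩
  intro V _ G hV hG h1 h2 h3
  refine hG.lt_graphB3 hN hp hV (fun u => ?_) h3
  by_contra! hu
  exact (hG.iso_of_dominating hn hV hu).elim h1 h2
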